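/- **Conventions.** Boolean functions take values in $\{-1,1\}$, where $-1$ stands for "true" and $1$ for "false". A function $f\colon\{0,1\}^n\to\{-1,1\}$ is a *halfspace* if there are reals $\alpha_1,\dots,\alpha_n,\theta$ with $f(x)=\operatorname{sign}\left(\sum_{i=1}^n\alpha_i x_i-\theta\right)$ for all $x\in\{0,1\}^n$, where $\operatorname{sign} t$ is $-1$, $0$, $1$ for $t<0$, $t=0$, $t>0$, respectively. The majority function $\mathrm{MAJ}_n\colon\{0,1\}^n\to\{-1,1\}$ equals $-1$ if $x_1+\cdots+x_n>n/2$ and $1$ otherwise. For $f\colon\{0,1\}^m\to\{-1,1\}$ and $g\colon\{0,1\}^n\to\{-1,1\}$, the conjunction $f\wedge g\colon\{0,1\}^{m}\times\{0,1\}^{n}\to\{-1,1\}$ is taken on disjoint sets of variables: $(f\wedge g)(x,y)=-1$ if $f(x)=g(y)=-1$, and $(f\wedge g)(x,y)=1$ otherwise. For $S\subseteq\{1,\dots,n\}$ let $\chi_S(x)=(-1)^{\sum_{i\in S}x_i}$. The *threshold density* $\mathrm{dns}(f)$ of $f\colon\{0,1\}^n\to\{-1,1\}$ is the minimum size $|\mathcal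 S|$ of a family $\mathcal S$ of subsets of $\{1,\dots,n\}$ such that, for some reals $\lambda_S$ $(S\in\mathcal S)$, one has $f(x)=\operatorname{sign}\left(\sum_{S\in\mathcal S}\lambda_S\chi_S(x)\right)$ for all $x\in\{0,1\}^n$. **Theorem.** There exist a family of halfspaces $h_n\colon\{0,1\}^n\to\{-1,1\}$, $n=1,2,3,\dots$, and absolute constants $c_1,c_2>0$ such that for every integer $n\ge1$, $$\mathrm{dns}(h_n\wedge h_n)\ \ge\ \exp\{c_1 n\},\qquad \mathrm{dns}(h_n\wedge \mathrm{MAJ}_n)\ \ge\ \exp\left\{c_2\sqrt{n\log_2 n}\right\}.$$ -/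

import Mathlib

noncomputable section

namespace ThresholdDensity

/-- A point of the Boolean cube `{0,1}^ι` is a map `ι → Bool`; this is its `i`-th coordinate,
read as the real number `0` or `1`. -/
def bit {ι : Type*} (x : ι → Bool) (i : ι) : ℝ := ((x i).toNat : ℝ)

/-- A Boolean function `{0,1}^ι → {-1,1}`. The value `-1` stands for "true" and the value `1`
for "false". -/
abbrev BoolFun (ι : Type*) : Type _ := (ι → Bool) → ℤˣ

/-- `f` is sign-represented by the real function `p`: `f(x) = sign p(x)` for every `x`, where
`Real.sign` is `-1`, `0`, `1` on negative numbers, zero, positive numbers respectively. -/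
def SignRep {ι : Type*} (f : BoolFun ι) (p : (ι → Bool) → ℝ) : Prop :=
  ∀ x, ((f x : ℤ) : ℝ) = Real.sign (p x)

/-- `f` is a halfspace: `f(x) = sign (∑ αᵢ xᵢ - θ)` for some reals `αᵢ`, `θ`. -/
def IsHalfspace {ι : Type*} [Fintype ι] (f : BoolFun ι) : Prop :=
  ∃ (α : ι → ℝ) (θ : ℝ), SignRep f (fun x => ∑ i, α i * bit x i - θ)

/-- The majority function on `{0,1}^n`: true (`-1`) iff `x₁ + ⋯ + xₙ > n / 2`. -/
def maj (n : ℕ) : BoolFun (Fin n) :=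
  fun x => if (n : ℝ) / 2 < ∑ i, bit x i then -1 else 1

/-- The conjunction `(f ∧ g)(x, y) = f(x) ∧ g(y)` of two Boolean functions on disjoint sets of
variables. A pair in `{0,1}^ι × {0,1}^κ` is read as a point of `{0,1}^(ι ⊕ κ)`. -/
def conj {ι κ : Type*} (f : BoolFun ι) (g : BoolFun κ) : BoolFun (ι ⊕ κ) :=
  fun z => if f (fun i => z (Sum.inl i)) = -1 ∧ g (fun j => z (Sum.inr j)) = -1 then -1 else 1

/-- The parity function (character) `χ_S(x) = (-1)^(∑_{i ∈ S} xᵢ)`. -/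
def chi {ι : Type*} (S : Finset ι) (x : ι → Bool) : ℝ :=
  (-1) ^ (∑ i ∈ S, (x i).toNat)

/-- The threshold density of `f`: the minimum size of a family `𝒮` of subsets of the set of
variables such that `f` is sign-represented by a real linear combination of the parity functions
`χ_S`, `S ∈ 𝒮`. Since the parity functions span all real functions on the cube, the minimum is
over a nonempty set. -/
def dns {ι : Type*} (f : BoolFun ι) : ℕ :=
  sInf {k : ℕ | ∃ 𝒮 : Finset (Finset ι), 𝒮.card = k ∧
    ∃ c : Finset ι → ℝ, SignRep f (fun x => ∑ S ∈ 𝒮, c S * chi S x)}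

end ThresholdDensity

end

/-!
A conjunction of lifted functions of small threshold density is turned into a polynomial of low
degree by a random restriction: each variable `bᵢ` of the base function becomes a block of four,
one half of which, chosen at random, holds `bᵢ` twice while the other half holds a random bit and
its negation. Averaging over the random bits annihilates every large character for a suitable
choice of the halves.

The halfspace is the sign of `∑ wᵢ xᵢ - 2 ^ q ∑ yⱼ`, with random weights `wᵢ` modulo `2 ^ q`, for
which every residue class of `∑ wᵢ xᵢ` supports a probability measure that annihilates all
nonempty characters of size at most `q` (second moments and linear programming duality). Choosing
`x` by such a measure, and `y` uniformly with the number of ones that makes the form equal to `t`,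
averages functions of low degree to polynomials in `t`, `0 < |t| < 2 ^ q`. Majority has the same
property on a shorter range by symmetrization.

A representation of the conjunction of degree `d` thus yields `P (t, τ)`, of degree at most `d` in
each variable, that is negative exactly where `t` and `τ` both are. Over the grid `1, 2, 4, …`, a
root changes `log |p (-t) / p t|` by a bounded total amount, so this distortion is `O(d)` in total
for a polynomial of degree `d`. Applied to `P (t, ·)`, it shows that `|log (P (t, τ) / P (t,
-τ))|` is less than `V` for most pairs. So for some `τ` and some integer `|k| ≤ V`, the
polynomials `P (·, τ)` and `exp k * P (·, -τ)` are close at a proportion of order `1 / V` of the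
grid points `t`. There their difference is small compared with `P (·, τ)`, but at `-t` it is large
since `P (-t, -τ) < 0`; the distortions of the two polynomials at `t` cannot both be small, and
the grid has at most `O(V d)` points. For two halfspaces `V = 1`. For majority, `τ` runs over too
short a range for the grid of powers, and a grid with harmonic weights takes its place, with
logarithms truncated at a larger `V`.
-/

noncomputable section

namespace ThresholdDensity

open Polynomial

/-! ### Distortion of a polynomial between opposite points -/

/-- The distance between `log |x|` and `log |y|`, truncated at `V`; it is `V` if `x` or `y`
vanishes. -/
def logDist (V x y : ℝ) : ℝ :=
  if x = 0 ∨ y = 0 then V else min V |Real.log x - Real.log y|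

lemma logDist_of_ne_zero {V x y : ℝ} (hx : x ≠ 0) (hy : y ≠ 0) :
    logDist V x y = min V |Real.log x - Real.log y| := by
  simp [logDist, hx, hy]

lemma logDist_of_eq_zero {V x y : ℝ} (h : x = 0 ∨ y = 0) : logDist V x y = V :=
  if_pos h

lemma logDist_nonneg {V : ℝ} (hV : 0 ≤ V) (x y : ℝ) : 0 ≤ logDist V x y := by
  unfold logDist
  split_ifs
  exacts [hV, le_min hV (abs_nonneg _)]

lemma logDist_le (V x y : ℝ) : logDist V x y ≤ V := by
  unfold logDist
  split_ifs
  exacts [le_rfl, min_le_left _ _]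

lemma logDist_abs_abs (V x y : ℝ) : logDist V |x| |y| = logDist V x y := by
  simp [logDist, Real.log_abs]

lemma logDist_neg_left (V x y : ℝ) : logDist V (-x) y = logDist V x y := by
  simp [logDist]

lemma logDist_comm (V x y : ℝ) : logDist V x y = logDist V y x := by
  simp only [logDist, or_comm, abs_sub_comm]

lemma logDist_self {V : ℝ} (hV : 0 ≤ V) {x : ℝ} (hx : x ≠ 0) : logDist V x x = 0 := by
  simp [logDist, hx, hV]

lemma logDist_mul_le {V : ℝ} (hV : 0 ≤ V) (x y x' y' : ℝ) :
    logDist V (x * x') (y * y') ≤ logDist V x y + logDist V x' y' := by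
  by_cases h : x = 0 ∨ y = 0
  · linarith [logDist_of_eq_zero (V := V) h, logDist_le V (x * x') (y * y'),
      logDist_nonneg hV x' y']
  by_cases h' : x' = 0 ∨ y' = 0
  · linarith [logDist_of_eq_zero (V := V) h', logDist_le V (x * x') (y * y'),
      logDist_nonneg hV x y]
  push Not at h h'
  rw [logDist_of_ne_zero h.1 h.2, logDist_of_ne_zero h'.1 h'.2,
    logDist_of_ne_zero (mul_ne_zero h.1 h'.1) (mul_ne_zero h.2 h'.2),
    Real.log_mul h.1 h'.1, Real.log_mul h.2 h'.2, add_sub_add_comm]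
  have triangle := abs_add_le (Real.log x - Real.log y) (Real.log x' - Real.log y')
  have := abs_nonneg (Real.log x - Real.log y)
  have := abs_nonneg (Real.log x' - Real.log y')
  grind

lemma logDist_multiset_prod_le {V : ℝ} (hV : 0 ≤ V) {α : Type*} (s : Multiset α) (f g : α → ℝ) :
    logDist V (s.map f).prod (s.map g).prod ≤ (s.map fun a => logDist V (f a) (g a)).sum := by
  induction s using Multiset.induction_on with
  | empty => simp [logDist_self hV one_ne_zero]
  | cons a s ih =>
    simp only [Multiset.map_cons, Multiset.prod_cons, Multiset.sum_cons]
    exact (logDist_mul_le hV _ _ _ _).trans (by gcongr)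

/-- Among all complex `z` of a given modulus, the real ones distort `|a + z| / |a - z|` most. -/
lemma logDist_norm_le {V a : ℝ} (ha : 0 < a) (z : ℂ) :
    logDist V ‖-(a : ℂ) - z‖ ‖(a : ℂ) - z‖ ≤ logDist V (a + ‖z‖) (a - ‖z‖) := by
  by_cases h : a - ‖z‖ = 0
  · exact (logDist_le _ _ _).trans_eq (logDist_of_eq_zero (.inr h)).symm
  have gap : 0 < |a - ‖z‖| := abs_pos.2 h
  have log_bounds (w : ℂ) (hw : ‖w‖ = ‖z‖) : 0 < ‖(a : ℂ) - w‖ ∧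
      Real.log (a - ‖z‖) ≤ Real.log ‖(a : ℂ) - w‖ ∧
      Real.log ‖(a : ℂ) - w‖ ≤ Real.log (a + ‖z‖) := by
    have lower : |a - ‖z‖| ≤ ‖(a : ℂ) - w‖ := by
      simpa [abs_of_pos ha, hw] using abs_norm_sub_norm_le (a : ℂ) w
    have upper : ‖(a : ℂ) - w‖ ≤ a + ‖z‖ := by
      simpa [abs_of_pos ha, hw] using norm_sub_le (a : ℂ) w
    have pos := gap.trans_le lower
    exact ⟨pos, Real.log_abs (a - ‖z‖) ▸ Real.log_le_log gap lower, Real.log_le_log pos upper⟩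
  obtain ⟨pos₁, lower₁, upper₁⟩ := log_bounds (-z) (norm_neg z)
  obtain ⟨pos₂, lower₂, upper₂⟩ := log_bounds z rfl
  have hneg : ‖-(a : ℂ) - z‖ = ‖(a : ℂ) - -z‖ := by rw [← norm_neg]; ring_nf
  have hsum : a + ‖z‖ ≠ 0 := by positivity
  rw [hneg, logDist_of_ne_zero pos₁.ne' pos₂.ne', logDist_of_ne_zero hsum h]
  refine min_le_min_left _ ((abs_le.2 ⟨?_, ?_⟩).trans (le_abs_self _)) <;> linarith

lemma abs_eval_eq_prod_roots (p : ℝ[X]) (x : ℝ) :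
    |p.eval x| = |p.leadingCoeff| *
      (((p.map (algebraMap ℝ ℂ)).roots).map fun z => ‖(x : ℂ) - z‖).prod := by
  set P := p.map (algebraMap ℝ ℂ) with hP
  have heval : P.eval (x : ℂ) = ((p.eval x : ℝ) : ℂ) := by
    simpa [hP] using eval_map_apply (f := algebraMap ℝ ℂ) (p := p) x
  have hprod := congrArg norm ((IsAlgClosed.splits P).eval_eq_prod_roots (x : ℂ))
  rw [heval, norm_mul, ← normHom_apply (Multiset.prod _), map_multiset_prod,
    Multiset.map_map] at hprod
  simpa [hP, leadingCoeff_map] using hprod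

/-- A finite set of positive points, with weights, at which a factor `X - r` distorts
`|p (-t)| / |p t|` by at most `E` in total, whatever the position `r ≥ 0` of its root is. -/
structure DistortionBound (V : ℝ) (s : Finset ℕ) (w : ℕ → ℝ) (E : ℝ) : Prop where
  pos : ∀ t ∈ s, 0 < t
  weight_nonneg : ∀ t ∈ s, 0 ≤ w t
  sum_le : ∀ r : ℝ, 0 ≤ r → ∑ t ∈ s, w t * logDist V (t + r) (t - r) ≤ E

namespace DistortionBound

variable {V E : ℝ} {s : Finset ℕ} {w : ℕ → ℝ}

lemma nonneg (h : DistortionBound V s w E) (hV : 0 ≤ V) : 0 ≤ E :=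
  (Finset.sum_nonneg fun t ht => mul_nonneg (h.weight_nonneg t ht) (logDist_nonneg hV _ _)).trans
    (h.sum_le 0 le_rfl)

lemma sum_eval_le (h : DistortionBound V s w E) (hV : 0 ≤ V) {p : ℝ[X]} (hp : p ≠ 0) {d : ℕ}
    (hd : p.natDegree ≤ d) :
    ∑ t ∈ s, w t * logDist V (p.eval (-t : ℝ)) (p.eval (t : ℝ)) ≤ d * E := by
  set R := (p.map (algebraMap ℝ ℂ)).roots
  have hcard : R.card = p.natDegree := by
    rw [← (IsAlgClosed.splits (p.map (algebraMap ℝ ℂ))).natDegree_eq_card_roots, natDegree_map]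
  have hlead : |p.leadingCoeff| ≠ 0 := by simpa using hp
  have pointwise : ∀ t ∈ s, logDist V (p.eval (-t : ℝ)) (p.eval (t : ℝ)) ≤
      (R.map fun z => logDist V (t + ‖z‖) (t - ‖z‖)).sum := by
    intro t ht
    rw [← logDist_abs_abs, abs_eval_eq_prod_roots, abs_eval_eq_prod_roots]
    refine (logDist_mul_le hV _ _ _ _).trans ?_
    rw [logDist_self hV hlead, zero_add]
    refine (logDist_multiset_prod_le hV _ _ _).trans (Multiset.sum_map_le_sum_map _ _ fun z _ => ?_)
    simpa using logDist_norm_le (V := V) (Nat.cast_pos.2 (h.pos t ht)) z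
  calc ∑ t ∈ s, w t * logDist V (p.eval (-t : ℝ)) (p.eval (t : ℝ))
      ≤ ∑ t ∈ s, w t * (R.map fun z => logDist V (t + ‖z‖) (t - ‖z‖)).sum :=
        Finset.sum_le_sum fun t ht =>
          mul_le_mul_of_nonneg_left (pointwise t ht) (h.weight_nonneg t ht)
    _ = (R.map fun z => ∑ t ∈ s, w t * logDist V (t + ‖z‖) (t - ‖z‖)).sum := by
        simp only [Finset.sum, Multiset.sum_map_sum_map, Multiset.sum_map_mul_left]
    _ ≤ R.card • E := by
        refine (Multiset.sum_le_card_nsmul _ E ?_).trans_eq (by rw [Multiset.card_map])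
        simpa using fun z _ => h.sum_le ‖z‖ (norm_nonneg z)
    _ ≤ d * E := by
        rw [hcard, nsmul_eq_mul]
        have := h.nonneg hV
        gcongr

end DistortionBound

/-! ### Grids -/

lemma logDist_le_log {V a r : ℝ} (ha : 0 < a) (hr : 0 ≤ r) (h : a ≠ r) :
    logDist V (a + r) (a - r) ≤ Real.log (1 + 2 * min a r / |a - r|) := by
  have hsum : 0 < a + r := by positivity
  have hdiff : a - r ≠ 0 := sub_ne_zero.2 h
  have gap : 0 < |a - r| := abs_pos.2 hdiff
  have gap_le : |a - r| ≤ a + r := abs_le.2 ⟨by linarith, by linarith⟩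
  have ratio : 1 + 2 * min a r / |a - r| = (a + r) / |a - r| := by
    rw [eq_div_iff gap.ne', add_mul, div_mul_cancel₀ _ gap.ne', one_mul]
    grind
  rw [ratio, Real.log_div hsum.ne' gap.ne', logDist_of_ne_zero hsum.ne' hdiff,
    ← Real.log_abs (a - r), abs_of_nonneg (sub_nonneg.2 (Real.log_le_log gap gap_le))]
  exact min_le_right _ _

lemma logDist_one_le_ratio {a r : ℝ} (ha : 0 < a) (hr : 0 ≤ r) :
    logDist 1 (a + r) (a - r) ≤ 24 * (2 * a / (2 * a + r) - a / (a + r)) := by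
  have ratio : 24 * (2 * a / (2 * a + r) - a / (a + r)) =
      24 * (a * r) / ((2 * a + r) * (a + r)) := by
    field_simp; ring
  have har := mul_nonneg ha.le hr
  rw [ratio]
  by_cases h : 2 * r < a ∨ 2 * a < r
  · have hne : a ≠ r := by grind
    have gap : 0 < |a - r| := abs_pos.2 (sub_ne_zero.2 hne)
    calc logDist 1 (a + r) (a - r) ≤ Real.log (1 + 2 * min a r / |a - r|) :=
          logDist_le_log ha hr hne
      _ ≤ 2 * min a r / |a - r| := by
          linarith [Real.log_le_sub_one_of_pos (show 0 < 1 + 2 * min a r / |a - r| by positivity)]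
      _ ≤ 24 * (a * r) / ((2 * a + r) * (a + r)) := by
          rw [div_le_div_iff₀ gap (by positivity)]
          rcases h with h | h
          · rw [min_eq_right (by linarith), abs_of_pos (by linarith)]
            nlinarith [mul_nonneg hr hr, mul_nonneg har (by linarith : 0 ≤ a - 2 * r),
              mul_nonneg (mul_nonneg hr hr) (by linarith : 0 ≤ a - 2 * r)]
          · rw [min_eq_left (by linarith), abs_of_neg (by linarith)]
            nlinarith [mul_nonneg hr hr, mul_nonneg har (by linarith : 0 ≤ r - 2 * a),
              mul_nonneg (mul_nonneg ha.le ha.le) (by linarith : 0 ≤ r - 2 * a)]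
  · push Not at h
    refine (logDist_le _ _ _).trans ((le_div_iff₀ (by positivity)).2 ?_)
    nlinarith [mul_nonneg (by linarith [h.1] : 0 ≤ 2 * r - a) (by linarith [h.2] : 0 ≤ 2 * a - r)]

lemma distortionBound_geometric (q : ℕ) :
    DistortionBound 1 ((Finset.range q).image (2 ^ ·)) (fun _ => 1) 24 where
  pos := by simp
  weight_nonneg := by simp
  sum_le r hr := by
    rw [Finset.sum_image fun i _ j _ h => Nat.pow_right_injective le_rfl h]
    calc ∑ i ∈ Finset.range q, 1 * logDist 1 (((2 ^ i : ℕ) : ℝ) + r) (((2 ^ i : ℕ) : ℝ) - r)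
        ≤ ∑ i ∈ Finset.range q, (24 * ((2 : ℝ) ^ (i + 1) / (2 ^ (i + 1) + r)) -
            24 * ((2 : ℝ) ^ i / (2 ^ i + r))) := by
          refine Finset.sum_le_sum fun i _ => ?_
          rw [one_mul, ← mul_sub, pow_succ']
          simpa using logDist_one_le_ratio (a := (2 : ℝ) ^ i) (by positivity) hr
      _ = 24 * ((2 : ℝ) ^ q / (2 ^ q + r)) - 24 * ((2 : ℝ) ^ 0 / (2 ^ 0 + r)) :=
          Finset.sum_range_sub (fun i => 24 * ((2 : ℝ) ^ i / (2 ^ i + r))) q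
      _ ≤ 24 := by
          have : (2 : ℝ) ^ q / (2 ^ q + r) ≤ 1 := div_le_one_of_le₀ (by linarith) (by positivity)
          have : 0 ≤ (2 : ℝ) ^ 0 / (2 ^ 0 + r) := by positivity
          linarith

lemma inv_sqrt_le {x : ℝ} (hx : 1 ≤ x) : 1 / √x ≤ 2 * (√x - √(x - 1)) := by
  have hpos : 0 < √x := Real.sqrt_pos.2 (by linarith)
  have sq := Real.sq_sqrt (by linarith : 0 ≤ x)
  have sq' := Real.sq_sqrt (by linarith : 0 ≤ x - 1)
  rw [div_le_iff₀ hpos]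
  nlinarith [sq_nonneg (√x - √(x - 1))]

lemma log_one_add_le_sqrt {x : ℝ} (hx : 0 ≤ x) : Real.log (1 + x) ≤ √x := by
  rw [Real.log_le_iff_le_exp (by positivity)]
  have taylor := Real.sum_le_exp_of_nonneg (Real.sqrt_nonneg x) 4
  norm_num [Finset.sum_range_succ, Nat.factorial] at taylor
  nlinarith [Real.sq_sqrt hx, Real.sqrt_nonneg x,
    mul_nonneg (Real.sqrt_nonneg x) (sq_nonneg (√x - 3 / 2))]

lemma logDist_le_sqrt {V a r : ℝ} (ha : 0 < a) (hr : 0 ≤ r) (h : a ≠ r) :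
    logDist V (a + r) (a - r) ≤ √(2 * min a r / |a - r|) :=
  (logDist_le_log ha hr h).trans (log_one_add_le_sqrt (by positivity))

lemma sum_le_sub_of_monotone {F φ : ℕ → ℝ} (hF : Monotone F) {T R : ℕ} (hTR : T ≤ R)
    {s : Finset ℕ} (hs : s ⊆ Finset.Ico T R) (hφ : ∀ t ∈ s, φ t ≤ F (t + 1) - F t) :
    ∑ t ∈ s, φ t ≤ F R - F T :=
  calc ∑ t ∈ s, φ t ≤ ∑ t ∈ s, (F (t + 1) - F t) := Finset.sum_le_sum hφ
    _ ≤ ∑ t ∈ Finset.Ico T R, (F (t + 1) - F t) :=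
        Finset.sum_le_sum_of_subset_of_nonneg hs fun t _ _ => sub_nonneg.2 (hF t.le_succ)
    _ = F R - F T := Finset.sum_Ico_sub F hTR

lemma inv_mul_sqrt_ratio_le {t g : ℝ} (ht : 0 < t) (hg : 0 < g) :
    1 / t * √(2 * t / g) ≤ 2 / √(t + g) * (1 / √g + 1 / √t) := by
  have ht' : 0 < √t := Real.sqrt_pos.2 ht
  have hg' : 0 < √g := Real.sqrt_pos.2 hg
  have : 0 < √(t + g) := Real.sqrt_pos.2 (by positivity)
  have sqrt_two : √2 ≤ 2 := by rw [Real.sqrt_le_left] <;> norm_num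
  have subadd : √(t + g) ≤ √t + √g := by
    rw [Real.sqrt_le_left (by positivity), add_sq, Real.sq_sqrt ht.le, Real.sq_sqrt hg.le]
    linarith [mul_pos ht' hg']
  calc 1 / t * √(2 * t / g) = √2 * √(t + g) / (√(t + g) * (√t * √g)) := by
        rw [Real.sqrt_div (by positivity), Real.sqrt_mul (by norm_num)]
        nth_rewrite 1 [← Real.sq_sqrt ht.le]
        field_simp
    _ ≤ 2 * (√t + √g) / (√(t + g) * (√t * √g)) := by gcongr
    _ = 2 / √(t + g) * (1 / √g + 1 / √t) := by field_simp

lemma inv_mul_logDist_left_le {V t r : ℝ} (ht : 1 ≤ t) (hr : t ≤ r - 1) :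
    1 / t * logDist V (t + r) (t - r) ≤
      4 / √r * (√(r - t) - √(r - (t + 1)) + (√t - √(t - 1))) := by
  have hdist := logDist_le_sqrt (V := V) (a := t) (r := r) (by linarith) (by linarith)
    (by linarith)
  rw [min_eq_left (by linarith), abs_of_neg (by linarith), neg_sub] at hdist
  have gap := inv_sqrt_le (x := r - t) (by linarith)
  rw [sub_sub] at gap
  have ratio := inv_mul_sqrt_ratio_le (t := t) (g := r - t) (by linarith) (by linarith)
  rw [add_sub_cancel] at ratio
  calc 1 / t * logDist V (t + r) (t - r) ≤ 1 / t * √(2 * t / (r - t)) :=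
        mul_le_mul_of_nonneg_left hdist (by positivity)
    _ ≤ 2 / √r * (1 / √(r - t) + 1 / √t) := ratio
    _ ≤ 2 / √r * (2 * (√(r - t) - √(r - (t + 1))) + 2 * (√t - √(t - 1))) := by
        have := inv_sqrt_le ht
        gcongr
    _ = 4 / √r * (√(r - t) - √(r - (t + 1)) + (√t - √(t - 1))) := by ring

lemma inv_mul_logDist_right_le {V t r : ℝ} (hr0 : 0 < r) (hr : r + 1 ≤ t) :
    1 / t * logDist V (t + r) (t - r) ≤
      8 * (√(t - r) / (√(t - r) + √r) - √(t - r - 1) / (√(t - r - 1) + √r)) := by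
  have hgap : 0 < t - r := by linarith
  have ht : 0 < t := by linarith
  have hdist := logDist_le_sqrt (V := V) (a := t) (r := r) ht hr0.le (by linarith)
  rw [min_eq_right (by linarith), abs_of_pos hgap] at hdist
  have step := inv_sqrt_le (x := t - r) (by linarith)
  set x := √(t - r) with hx_def
  set y := √(t - r - 1)
  have hsr : 0 < √r := Real.sqrt_pos.2 hr0
  have hx : 0 < x := Real.sqrt_pos.2 hgap
  have hy : 0 ≤ y := Real.sqrt_nonneg _
  have hyx : y ≤ x := Real.sqrt_le_sqrt (by linarith)
  have hprod : (x + √r) * (y + √r) ≤ 2 * t := by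
    nlinarith [sq_nonneg (x - √r), mul_nonneg (sub_nonneg.2 hyx) hx.le,
      mul_nonneg (sub_nonneg.2 hyx) hsr.le, Real.sq_sqrt hgap.le, Real.sq_sqrt hr0.le]
  have sqrt_two : √2 ≤ 2 := by rw [Real.sqrt_le_left] <;> norm_num
  calc 1 / t * logDist V (t + r) (t - r) ≤ 1 / t * √(2 * r / (t - r)) :=
        mul_le_mul_of_nonneg_left hdist (by positivity)
    _ = √2 * √r / t * (1 / x) := by
        rw [Real.sqrt_div (by positivity), Real.sqrt_mul (by norm_num), ← hx_def]
        field_simp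
    _ ≤ 2 * √r / t * (2 * (x - y)) := by gcongr
    _ = 8 * (√r * (x - y)) / (2 * t) := by field_simp; ring
    _ ≤ 8 * (√r * (x - y)) / ((x + √r) * (y + √r)) := by
        have := sub_nonneg.2 hyx
        gcongr
    _ = 8 * (x / (x + √r) - y / (y + √r)) := by field_simp; ring

section HarmonicGrid

variable {T R : ℕ} {V r : ℝ}

lemma sum_harmonic_left_le (hT : 1 ≤ T) (hTR : T ≤ R) (hr : 0 < r) :
    ∑ t ∈ Finset.Ico T R with ((t : ℕ) : ℝ) ≤ r - 1,
      1 / (t : ℝ) * logDist V (t + r) (t - r) ≤ 8 := by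
  have : 0 < √r := Real.sqrt_pos.2 hr
  set F : ℕ → ℝ := fun t => 4 / √r * (√(min ((t : ℝ) - 1) r) - √(r - t))
  have hF : Monotone F := by
    intro a b hab
    have : (a : ℝ) ≤ b := by exact_mod_cast hab
    dsimp only [F]
    gcongr
  refine (sum_le_sub_of_monotone hF hTR (Finset.filter_subset _ _) fun t ht => ?_).trans ?_
  · obtain ⟨ht, htr⟩ := Finset.mem_filter.1 ht
    have ht1 : (1 : ℝ) ≤ t := by exact_mod_cast hT.trans (Finset.mem_Ico.1 ht).1
    refine (inv_mul_logDist_left_le ht1 htr).trans_eq ?_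
    dsimp only [F]
    push_cast
    rw [min_eq_left (by linarith), min_eq_left (by linarith), add_sub_cancel_right]
    ring
  · have upper : √(min ((R : ℝ) - 1) r) - √(r - R) ≤ √r := by
      linarith [Real.sqrt_le_sqrt (min_le_right ((R : ℝ) - 1) r), Real.sqrt_nonneg (r - R)]
    have lower : -√r ≤ √(min ((T : ℝ) - 1) r) - √(r - T) := by
      linarith [Real.sqrt_le_sqrt (by linarith [T.cast_nonneg (α := ℝ)] : r - T ≤ r),
        Real.sqrt_nonneg (min ((T : ℝ) - 1) r)]
    calc F R - F T ≤ 4 / √r * √r - 4 / √r * -√r := by dsimp only [F]; gcongr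
      _ = 8 := by field_simp; norm_num

lemma sum_harmonic_right_le (hTR : T ≤ R) (hr : 0 < r) :
    ∑ t ∈ Finset.Ico T R with r + 1 ≤ ((t : ℕ) : ℝ),
      1 / (t : ℝ) * logDist V (t + r) (t - r) ≤ 8 := by
  have hr' : 0 < √r := Real.sqrt_pos.2 hr
  set F : ℕ → ℝ := fun t => 8 * (√((t : ℝ) - r - 1) / (√((t : ℝ) - r - 1) + √r))
  have hF : Monotone F := by
    intro a b hab
    have hab : (a : ℝ) ≤ b := by exact_mod_cast hab
    have : √((a : ℝ) - r - 1) ≤ √((b : ℝ) - r - 1) := Real.sqrt_le_sqrt (by linarith)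
    refine mul_le_mul_of_nonneg_left ?_ (by norm_num)
    rw [div_le_div_iff₀ (by positivity) (by positivity)]
    nlinarith
  refine (sum_le_sub_of_monotone hF hTR (Finset.filter_subset _ _) fun t ht => ?_).trans ?_
  · refine (inv_mul_logDist_right_le hr (Finset.mem_filter.1 ht).2).trans_eq ?_
    simp only [F, ← mul_sub, Nat.cast_add, Nat.cast_one,
      show (t : ℝ) + 1 - r - 1 = t - r by ring]
  · have upper : √((R : ℝ) - r - 1) / (√((R : ℝ) - r - 1) + √r) ≤ 1 :=
      div_le_one_of_le₀ (by linarith) (by positivity)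
    have lower : 0 ≤ F T := by positivity
    dsimp only [F] at lower ⊢
    linarith

lemma sum_harmonic_near_le (hT : 1 ≤ T) (hVT : V ≤ T) (hr : 0 ≤ r) :
    ∑ t ∈ Finset.Ico T R with |((t : ℕ) : ℝ) - r| < 1,
      1 / (t : ℝ) * logDist V (t + r) (t - r) ≤ 2 := by
  have hsub : {t ∈ Finset.Ico T R | |((t : ℕ) : ℝ) - r| < 1} ⊆ {⌊r⌋₊, ⌊r⌋₊ + 1} := by
    intro t ht
    obtain ⟨lower, upper⟩ := abs_lt.1 (Finset.mem_filter.1 ht).2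
    have : ⌊r⌋₊ < t + 1 := (Nat.floor_lt hr).2 (by push_cast; linarith)
    have : t < ⌊r⌋₊ + 2 := by
      have := Nat.lt_floor_add_one r
      exact_mod_cast (by linarith : (t : ℝ) < ⌊r⌋₊ + 2)
    simp only [Finset.mem_insert, Finset.mem_singleton]
    omega
  have hterm : ∀ t ∈ {t ∈ Finset.Ico T R | |((t : ℕ) : ℝ) - r| < 1},
      1 / (t : ℝ) * logDist V (t + r) (t - r) ≤ 1 := by
    intro t ht
    have hTt : T ≤ t := (Finset.mem_Ico.1 (Finset.mem_filter.1 ht).1).1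
    have hTt' : (T : ℝ) ≤ t := by exact_mod_cast hTt
    rw [one_div, inv_mul_le_iff₀ (by exact_mod_cast hT.trans hTt), mul_one]
    exact (logDist_le _ _ _).trans (hVT.trans hTt')
  refine (Finset.sum_le_card_nsmul _ _ 1 hterm).trans ?_
  rw [nsmul_one]
  exact_mod_cast (Finset.card_le_card hsub).trans Finset.card_le_two

lemma distortionBound_harmonic (hT : 1 ≤ T) (hTR : T ≤ R) (hV : 0 ≤ V) (hVT : V ≤ T) :
    DistortionBound V (Finset.Ico T R) (fun t => 1 / t) 18 where
  pos t ht := hT.trans (Finset.mem_Ico.1 ht).1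
  weight_nonneg _ _ := by positivity
  sum_le r hr := by
    rcases hr.eq_or_lt with rfl | hr
    · refine (Finset.sum_nonpos fun t ht => ?_).trans (by norm_num)
      have : (t : ℝ) ≠ 0 := by
        exact_mod_cast Nat.ne_of_gt (hT.trans (Finset.mem_Ico.1 ht).1)
      simp [logDist_self hV this]
    set φ : ℕ → ℝ := fun t => 1 / (t : ℝ) * logDist V (t + r) (t - r)
    have hφ (t : ℕ) : 0 ≤ φ t := mul_nonneg (by positivity) (logDist_nonneg hV _ _)
    calc ∑ t ∈ Finset.Ico T R, φ t
        ≤ ∑ t ∈ Finset.Ico T R, ((if (t : ℝ) ≤ r - 1 then φ t else 0) +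
            (if r + 1 ≤ (t : ℝ) then φ t else 0) + if |(t : ℝ) - r| < 1 then φ t else 0) := by
          refine Finset.sum_le_sum fun t _ => ?_
          have := hφ t
          by_cases near : |(t : ℝ) - r| < 1
          · rw [if_pos near]; split_ifs <;> linarith
          · rcases le_abs.1 (not_lt.1 near) with h | h
            · rw [if_pos (by linarith : r + 1 ≤ (t : ℝ))]; split_ifs <;> linarith
            · rw [if_pos (by linarith : (t : ℝ) ≤ r - 1)]; split_ifs <;> linarith
      _ ≤ 8 + 8 + 2 := by
          rw [Finset.sum_add_distrib, Finset.sum_add_distrib, ← Finset.sum_filter,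
            ← Finset.sum_filter, ← Finset.sum_filter]
          gcongr
          exacts [sum_harmonic_left_le hT hTR hr, sum_harmonic_right_le hTR hr,
            sum_harmonic_near_le hT hVT hr.le]
      _ = 18 := by norm_num

end HarmonicGrid

/-! ### Sign patterns of conjunctions -/

lemma abs_lt_exp_mul_abs_of_logDist_lt {V δ x y : ℝ} (hδ : δ ≤ V) (h : logDist V x y < δ) :
    |x| < Real.exp δ * |y| := by
  by_cases h0 : x = 0 ∨ y = 0
  · exact absurd (logDist_of_eq_zero h0) (h.trans_le hδ).ne
  push Not at h0
  rw [logDist_of_ne_zero h0.1 h0.2] at h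
  have hlog := (abs_lt.1 ((min_lt_iff.1 h).resolve_left hδ.not_gt)).2
  rw [← Real.log_lt_log_iff (abs_pos.2 h0.1) (by have := abs_pos.2 h0.2; positivity),
    Real.log_mul (Real.exp_ne_zero _) (abs_ne_zero.2 h0.2), Real.log_exp, Real.log_abs,
    Real.log_abs]
  linarith

/-- If `a` is close to `c`, then one cannot have `a'` close to `a`, `c'` close to `c` and
`a' + c'` close to `a - c`. -/
lemma le_logDist_add_sub {a c a' c' : ℝ} (ha : 0 < a) (hc : 0 < c) (ha' : 0 < a') (hc' : 0 < c')
    (h : |Real.log a - Real.log c| ≤ 1 / 2) :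
    1 / 4 ≤ logDist 1 a' a + logDist 1 c' c + logDist 1 (a' + c') (a - c) := by
  by_contra! hlt
  have := logDist_nonneg zero_le_one a' a
  have := logDist_nonneg zero_le_one c' c
  have := logDist_nonneg zero_le_one (a' + c') (a - c)
  have small (x y : ℝ) (hxy : logDist 1 x y < 1 / 4) : |x| < Real.exp (1 / 4) * |y| :=
    abs_lt_exp_mul_abs_of_logDist_lt (by norm_num) hxy
  have near_a := small a a' (by rw [logDist_comm]; linarith)
  have near_c := small c c' (by rw [logDist_comm]; linarith)
  have near_diff := small (a' + c') (a - c) (by linarith)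
  rw [abs_of_pos ha, abs_of_pos ha'] at near_a
  rw [abs_of_pos hc, abs_of_pos hc'] at near_c
  rw [abs_of_pos (add_pos ha' hc')] at near_diff
  have hexp (x y : ℝ) (hx : 0 < x) (hy : 0 < y) (hxy : Real.log x - Real.log y ≤ 1 / 2) :
      x ≤ Real.exp (1 / 2) * y := by
    rw [← Real.log_le_log_iff hx (by positivity), Real.log_mul (by positivity) hy.ne',
      Real.log_exp]
    linarith
  have hac := hexp a c ha hc (abs_le.1 h).2
  have hca := hexp c a hc ha (by linarith [(abs_le.1 h).1])
  have exp_sq : Real.exp (1 / 4) ^ 2 = Real.exp (1 / 2) := by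
    rw [← Real.exp_nat_mul]; norm_num
  have exp_half_lt : Real.exp (1 / 2) < 1.7 := by
    have : Real.exp (1 / 2) ^ 2 = Real.exp 1 := by rw [← Real.exp_nat_mul]; norm_num
    nlinarith [Real.exp_one_lt_d9, Real.exp_pos (1 / 2)]
  have contraction : a + c < Real.exp (1 / 2) * |a - c| :=
    calc a + c < Real.exp (1 / 4) * (a' + c') := by linarith
      _ ≤ Real.exp (1 / 4) * (Real.exp (1 / 4) * |a - c|) := by gcongr
      _ = Real.exp (1 / 2) * |a - c| := by rw [← exp_sq]; ring
  rcases abs_cases (a - c) with ⟨e, _⟩ | ⟨e, _⟩ <;> rw [e] at contraction <;> nlinarith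

section Columns

variable {s : Finset ℕ} {d : ℕ} {E : ℝ} {p p' : ℝ[X]}

lemma card_log_near_le (hs : DistortionBound 1 s (fun _ => 1) E) (hp : p.natDegree ≤ d)
    (hp' : p'.natDegree ≤ d)
    (hsign : ∀ t ∈ s, 0 < p.eval (t : ℝ) ∧ 0 < p.eval (-t : ℝ) ∧ 0 < p'.eval (t : ℝ) ∧
      p'.eval (-t : ℝ) < 0) :
    ({t ∈ s | |Real.log (p.eval ((t : ℕ) : ℝ)) - Real.log (p'.eval (t : ℝ))| ≤ 1 / 2}.card : ℝ) ≤
      12 * (d * E) := by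
  set near := {t ∈ s | |Real.log (p.eval ((t : ℕ) : ℝ)) - Real.log (p'.eval (t : ℝ))| ≤ 1 / 2}
  rcases s.eq_empty_or_nonempty with rfl | ⟨t₀, ht₀⟩
  · have := hs.nonneg zero_le_one
    simp only [near, Finset.filter_empty, Finset.card_empty, Nat.cast_zero]
    positivity
  have hdiff : (p - p').natDegree ≤ d := (natDegree_sub_le _ _).trans (max_le hp hp')
  have ne_zero {r : ℝ[X]} {x : ℝ} (h : r.eval x ≠ 0) : r ≠ 0 := by rintro rfl; simp at h
  obtain ⟨hpos, hpos', hpos'', hneg⟩ := hsign t₀ ht₀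
  let D (r : ℝ[X]) (t : ℕ) : ℝ := logDist 1 (r.eval (-t : ℝ)) (r.eval (t : ℝ))
  have total {r : ℝ[X]} (hr : r ≠ 0) (hrd : r.natDegree ≤ d) : ∑ t ∈ s, D r t ≤ d * E := by
    simpa using hs.sum_eval_le zero_le_one hr hrd
  have D_nonneg (r : ℝ[X]) (t : ℕ) : 0 ≤ D r t := logDist_nonneg zero_le_one _ _
  have quarter : ∑ t ∈ near, (1 / 4 : ℝ) ≤ ∑ t ∈ s, (D p t + D p' t + D (p - p') t) := by
    refine (Finset.sum_le_sum fun t ht => ?_).trans <|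
      Finset.sum_le_sum_of_subset_of_nonneg (Finset.filter_subset _ s) fun t _ _ =>
        add_nonneg (add_nonneg (D_nonneg p t) (D_nonneg p' t)) (D_nonneg _ t)
    obtain ⟨ht, hnear⟩ := Finset.mem_filter.1 ht
    obtain ⟨h1, h2, h3, h4⟩ := hsign t ht
    simpa only [D, eval_sub, logDist_neg_left, ← sub_eq_add_neg] using
      le_logDist_add_sub h1 h3 h2 (neg_pos.2 h4) hnear
  rw [Finset.sum_const, nsmul_eq_mul, Finset.sum_add_distrib, Finset.sum_add_distrib] at quarter
  linarith [total (ne_zero hpos.ne') hp, total (ne_zero hpos''.ne') hp', total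
    (ne_zero (x := -t₀) (by rw [eval_sub]; linarith)) hdiff]

lemma card_log_dist_lt_le (hs : DistortionBound 1 s (fun _ => 1) E) (hp : p.natDegree ≤ d)
    (hp' : p'.natDegree ≤ d)
    (hsign : ∀ t ∈ s, 0 < p.eval (t : ℝ) ∧ 0 < p.eval (-t : ℝ) ∧ 0 < p'.eval (t : ℝ) ∧
      p'.eval (-t : ℝ) < 0) (V : ℕ) :
    ({t ∈ s | |Real.log (p.eval ((t : ℕ) : ℝ)) - Real.log (p'.eval (t : ℝ))| < V}.card : ℝ) ≤
      (2 * V + 1) * (12 * (d * E)) := by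
  set v : ℕ → ℝ := fun t => Real.log (p.eval (t : ℝ)) - Real.log (p'.eval (t : ℝ))
  let near (k : ℤ) : Finset ℕ := {t ∈ s | |v t - k| ≤ 1 / 2}
  have card_near (k : ℤ) : ((near k).card : ℝ) ≤ 12 * (d * E) := by
    have := card_log_near_le hs hp (p' := C (Real.exp k) * p')
      ((natDegree_C_mul_le _ _).trans hp') fun t ht => by
        simpa [Real.exp_pos, mul_neg_iff, (Real.exp_pos _).not_gt] using hsign t ht
    refine le_trans (le_of_eq ?_) this
    congr 2
    refine Finset.filter_congr fun t ht => ?_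
    rw [eval_C_mul, Real.log_mul (Real.exp_ne_zero _) (hsign t ht).2.2.1.ne', Real.log_exp,
      sub_sub, add_comm]
  have cover : {t ∈ s | |v t| < V} ⊆ (Finset.Icc (-(V : ℤ)) V).biUnion near := by
    intro t ht
    obtain ⟨ht, hv⟩ := Finset.mem_filter.1 ht
    obtain ⟨lower, upper⟩ := abs_lt.1 hv
    obtain ⟨lower', upper'⟩ := abs_le.1 (abs_sub_round (v t))
    refine Finset.mem_biUnion.2 ⟨round (v t), Finset.mem_Icc.2 ⟨?_, ?_⟩,
      Finset.mem_filter.2 ⟨ht, abs_sub_round _⟩⟩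
    · exact Int.lt_add_one_iff.1 (by exact_mod_cast (by linarith : (-V : ℝ) < round (v t) + 1))
    · exact Int.lt_add_one_iff.1 (by exact_mod_cast (by linarith : (round (v t) : ℝ) < V + 1))
  calc ({t ∈ s | |v t| < V}.card : ℝ) ≤ ∑ k ∈ Finset.Icc (-(V : ℤ)) V, ((near k).card : ℝ) := by
        exact_mod_cast (Finset.card_le_card cover).trans Finset.card_biUnion_le
    _ ≤ (Finset.Icc (-(V : ℤ)) V).card • (12 * (d * E)) :=
        Finset.sum_le_card_nsmul _ _ _ fun k _ => card_near k
    _ = (2 * V + 1) * (12 * (d * E)) := by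
        rw [Int.card_Icc, nsmul_eq_mul,
          show ((V : ℤ) + 1 - -(V : ℤ)).toNat = 2 * V + 1 by omega]
        push_cast
        ring

lemma weight_log_dist_ge_le {V : ℝ} (hV : 0 ≤ V) {w : ℕ → ℝ} (hs : DistortionBound V s w E)
    (hp : p.natDegree ≤ d) (hsign : ∀ t ∈ s, 0 < p.eval (t : ℝ) ∧ 0 < p.eval (-t : ℝ)) :
    V * ∑ t ∈ s with V ≤ |Real.log (p.eval ((t : ℕ) : ℝ)) - Real.log (p.eval (-t : ℝ))|, w t ≤
      d * E := by
  rcases s.eq_empty_or_nonempty with rfl | ⟨t₀, ht₀⟩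
  · have := hs.nonneg hV
    simp only [Finset.filter_empty, Finset.sum_empty, mul_zero]
    positivity
  have hp0 : p ≠ 0 := by rintro rfl; simpa using (hsign t₀ ht₀).1
  refine le_trans ?_ (hs.sum_eval_le hV hp0 hp)
  rw [Finset.mul_sum]
  refine (Finset.sum_le_sum fun t ht => ?_).trans <|
    Finset.sum_le_sum_of_subset_of_nonneg (Finset.filter_subset _ s) fun t ht _ =>
      mul_nonneg (hs.weight_nonneg t ht) (logDist_nonneg hV _ _)
  obtain ⟨ht, hfar⟩ := Finset.mem_filter.1 ht
  rw [logDist_of_ne_zero (hsign t ht).2.ne' (hsign t ht).1.ne', abs_sub_comm, min_eq_left hfar,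
    mul_comm]

end Columns

lemma exists_card_filter_le_of_forall_sum_filter_le {α β : Type*} {s : Finset α} {u : Finset β}
    {w : β → ℝ} (hw : ∀ b ∈ u, 0 ≤ w b) (hW : 0 < ∑ b ∈ u, w b) {c : ℝ}
    (far : α → β → Prop) [∀ a, DecidablePred (far a)]
    (h : ∀ a ∈ s, ∑ b ∈ u with far a b, w b ≤ c * ∑ b ∈ u, w b) :
    ∃ b ∈ u, ({a ∈ s | far a b}.card : ℝ) ≤ c * s.card := by
  by_contra! hcon
  obtain ⟨b₀, hb₀, hwb₀⟩ := Finset.exists_lt_of_sum_lt (f := fun _ => (0 : ℝ)) (s := u) (g := w)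
    (by simpa using hW)
  refine lt_irrefl (c * s.card * ∑ b ∈ u, w b) ?_
  calc c * s.card * ∑ b ∈ u, w b = ∑ b ∈ u, w b * (c * s.card) := by
        rw [Finset.mul_sum]; simp only [mul_comm]
    _ < ∑ b ∈ u, w b * {a ∈ s | far a b}.card :=
        Finset.sum_lt_sum (fun b hb => mul_le_mul_of_nonneg_left (hcon b hb).le (hw b hb))
          ⟨b₀, hb₀, mul_lt_mul_of_pos_left (hcon b₀ hb₀) hwb₀⟩
    _ = ∑ a ∈ s, ∑ b ∈ u with far a b, w b := by
        simp only [Finset.sum_filter, Finset.card_filter, Nat.cast_sum, Finset.mul_sum]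
        rw [Finset.sum_comm]
        simp
    _ ≤ s.card • (c * ∑ b ∈ u, w b) := Finset.sum_le_card_nsmul _ _ _ h
    _ = c * s.card * ∑ b ∈ u, w b := by rw [nsmul_eq_mul]; ring

/-- `φ` agrees on the set `A` of integers with a real polynomial of degree at most `d`. -/
def IsPolyOn (d : ℕ) (A : Set ℤ) (φ : ℤ → ℝ) : Prop :=
  ∃ Q : ℝ[X], Q.natDegree ≤ d ∧ ∀ t ∈ A, φ t = Q.eval (t : ℝ)

namespace IsPolyOn

variable {d : ℕ} {A : Set ℤ} {φ ψ : ℤ → ℝ}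

lemma congr (h : IsPolyOn d A φ) (hψ : ∀ t ∈ A, ψ t = φ t) : IsPolyOn d A ψ := by
  obtain ⟨Q, hQ, hφ⟩ := h
  exact ⟨Q, hQ, fun t ht => (hψ t ht).trans (hφ t ht)⟩

lemma zero : IsPolyOn d A fun _ => 0 := ⟨0, by simp, by simp⟩

lemma add (h : IsPolyOn d A φ) (h' : IsPolyOn d A ψ) : IsPolyOn d A fun t => φ t + ψ t := by
  obtain ⟨Q, hQ, hφ⟩ := h
  obtain ⟨Q', hQ', hψ⟩ := h'
  exact ⟨Q + Q', (natDegree_add_le _ _).trans (max_le hQ hQ'), fun t ht => by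
    simp only [eval_add, hφ t ht, hψ t ht]⟩

lemma const_mul (c : ℝ) (h : IsPolyOn d A φ) : IsPolyOn d A fun t => c * φ t := by
  obtain ⟨Q, hQ, hφ⟩ := h
  exact ⟨C c * Q, (natDegree_C_mul_le _ _).trans hQ, fun t ht => by
    simp only [eval_C_mul, hφ t ht]⟩

lemma sum {κ : Type*} {Φ : κ → ℤ → ℝ} (K : Finset κ) (h : ∀ k ∈ K, IsPolyOn d A (Φ k)) :
    IsPolyOn d A fun t => ∑ k ∈ K, Φ k t := by
  choose! Q hQ hΦ using h
  exact ⟨∑ k ∈ K, Q k, natDegree_sum_le_of_forall_le _ _ hQ, fun t ht => by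
    rw [eval_finsetSum]
    exact Finset.sum_congr rfl fun k hk => hΦ k hk t ht⟩

lemma eval_add_mul {R : ℝ[X]} (hR : R.natDegree ≤ d) (a b : ℝ) :
    IsPolyOn d A fun t => R.eval (a + b * t) := by
  refine ⟨R.comp (C b * X + C a), ?_, fun t _ => by simp [add_comm]⟩
  rw [natDegree_comp]
  exact (Nat.mul_le_mul_left _ natDegree_linear_le).trans (by rwa [mul_one])

end IsPolyOn

/-- A set of integers contains the grid `±t`, `t ∈ s`. -/
def ContainsGrid (A : Set ℤ) (s : Finset ℕ) : Prop :=
  ∀ t ∈ s, (t : ℤ) ∈ A ∧ -(t : ℤ) ∈ A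

lemma IsPolyOn.mul_sum_weight_log_dist_ge_le {B : Set ℤ} {φ : ℤ → ℝ} {d : ℕ} {u : Finset ℕ}
    {V E : ℝ} {w : ℕ → ℝ} (hφ : IsPolyOn d B φ) (hu : DistortionBound V u w E) (hV : 0 ≤ V)
    (huB : ContainsGrid B u) (hpos : ∀ τ ∈ u, 0 < φ τ ∧ 0 < φ (-τ)) :
    V * ∑ τ ∈ u with V ≤ |Real.log (φ ((τ : ℕ) : ℤ)) - Real.log (φ (-τ))|, w τ ≤ d * E := by
  obtain ⟨p, hpd, hp⟩ := hφ
  have eval_pos : ∀ τ ∈ u, φ τ = p.eval (τ : ℝ) := fun τ hτ => by simpa using hp τ (huB τ hτ).1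
  have eval_neg : ∀ τ ∈ u, φ (-τ) = p.eval (-τ : ℝ) := fun τ hτ => by
    simpa using hp (-τ) (huB τ hτ).2
  have := weight_log_dist_ge_le hV hu hpd fun τ hτ => by
    rw [← eval_pos τ hτ, ← eval_neg τ hτ]
    exact hpos τ hτ
  rwa [Finset.filter_congr fun τ hτ => by rw [eval_pos τ hτ, eval_neg τ hτ]]

theorem card_le_of_sign_pattern {A B : Set ℤ} {P : ℤ → ℤ → ℝ} {d : ℕ}
    (hPA : ∀ τ ∈ B, IsPolyOn d A fun t => P t τ) (hPB : ∀ t ∈ A, IsPolyOn d B (P t))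
    (hneg : ∀ t ∈ A, ∀ τ ∈ B, t < 0 → τ < 0 → P t τ < 0)
    (hpos : ∀ t ∈ A, ∀ τ ∈ B, 0 < t ∨ 0 < τ → 0 < P t τ)
    {s u : Finset ℕ} {w : ℕ → ℝ} {V : ℕ} {E E' : ℝ} (hsA : ContainsGrid A s)
    (huB : ContainsGrid B u) (hs : DistortionBound 1 s (fun _ => 1) E)
    (hu : DistortionBound V u w E') (hV : 1 ≤ V) (hW : 0 < ∑ τ ∈ u, w τ)
    (hVW : 4 * (d * E') ≤ V * ∑ τ ∈ u, w τ) :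
    (s.card : ℝ) ≤ 16 * (2 * V + 1) * (d * E) := by
  have hV' : (0 : ℝ) < V := by exact_mod_cast hV
  let far (t τ : ℕ) : Prop := V ≤ |Real.log (P t τ) - Real.log (P t (-τ))|
  have rows : ∀ t ∈ s, ∑ τ ∈ u with far t τ, w τ ≤ 1 / 4 * ∑ τ ∈ u, w τ := by
    intro t ht
    have ht0 : (0 : ℤ) < t := by exact_mod_cast hs.pos t ht
    have := (hPB t (hsA t ht).1).mul_sum_weight_log_dist_ge_le hu hV'.le huB fun τ hτ =>
      ⟨hpos _ (hsA t ht).1 _ (huB τ hτ).1 (.inl ht0),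
        hpos _ (hsA t ht).1 _ (huB τ hτ).2 (.inl ht0)⟩
    nlinarith
  obtain ⟨τ, hτ, few_far⟩ :=
    exists_card_filter_le_of_forall_sum_filter_le hu.weight_nonneg hW far rows
  have hτ0 : (0 : ℤ) < τ := by exact_mod_cast hu.pos τ hτ
  obtain ⟨hτB, hτB'⟩ := huB τ hτ
  obtain ⟨p, hpd, hp⟩ := hPA τ hτB
  obtain ⟨p', hpd', hp'⟩ := hPA (-τ) hτB'
  have few_near := card_log_dist_lt_le hs hpd hpd' (V := V) fun t ht => by
    obtain ⟨htA, htA'⟩ := hsA t ht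
    have ht0 : (0 : ℤ) < t := by exact_mod_cast hs.pos t ht
    have h1 := hpos _ htA _ hτB (.inl ht0)
    have h2 := hpos _ htA' _ hτB (.inr hτ0)
    have h3 := hpos _ htA _ hτB' (.inl ht0)
    have h4 := hneg _ htA' _ hτB' (neg_lt_zero.2 ht0) (neg_lt_zero.2 hτ0)
    simpa only [hp _ htA, hp _ htA', hp' _ htA, hp' _ htA', Int.cast_neg, Int.cast_natCast]
      using And.intro h1 (And.intro h2 (And.intro h3 h4))
  have hnear : {t ∈ s | ¬ far t τ} =
      {t ∈ s | |Real.log (p.eval ((t : ℕ) : ℝ)) - Real.log (p'.eval (t : ℝ))| < V} :=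
    Finset.filter_congr fun t ht => by
      simp only [far, not_le, hp _ (hsA t ht).1, hp' _ (hsA t ht).1, Int.cast_natCast]
  have split : ({t ∈ s | far t τ}.card : ℝ) + {t ∈ s | ¬ far t τ}.card = s.card := by
    exact_mod_cast Finset.card_filter_add_card_filter_not (s := s) (fun t => far t τ)
  rw [hnear] at split
  linarith

/-! ### Characters and threshold density -/

section Characters

variable {ι κ : Type*}

lemma chi_eq_prod (S : Finset ι) (x : ι → Bool) : chi S x = ∏ i ∈ S, (-1) ^ (x i).toNat :=
  (Finset.prod_pow_eq_pow_sum _ _ _).symm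

lemma chi_empty (x : ι → Bool) : chi ∅ x = 1 := by simp [chi]

lemma abs_chi (S : Finset ι) (x : ι → Bool) : |chi S x| = 1 := by simp [chi]

lemma chi_mul_self (S : Finset ι) (x : ι → Bool) : chi S x * chi S x = 1 := by
  rw [← sq, ← sq_abs, abs_chi, one_pow]

lemma chi_union [DecidableEq ι] {S T : Finset ι} (h : Disjoint S T) (x : ι → Bool) :
    chi (S ∪ T) x = chi S x * chi T x := by
  simp only [chi_eq_prod, Finset.prod_union h]

lemma chi_mul_chi [DecidableEq ι] (S T : Finset ι) (x : ι → Bool) :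
    chi S x * chi T x = chi (symmDiff S T) x := by
  have hS : chi S x = chi (S \ T) x * chi (S ∩ T) x := by
    rw [← chi_union (Finset.disjoint_sdiff_inter S T), Finset.sdiff_union_inter]
  have hT : chi T x = chi (T \ S) x * chi (S ∩ T) x := by
    rw [Finset.inter_comm, ← chi_union (Finset.disjoint_sdiff_inter T S),
      Finset.sdiff_union_inter]
  rw [hS, hT, symmDiff_def, Finset.sup_eq_union, chi_union disjoint_sdiff_sdiff]
  linear_combination chi (S \ T) x * chi (T \ S) x * chi_mul_self (S ∩ T) x

lemma chi_sumElim (T : Finset (ι ⊕ κ)) (x : ι → Bool) (y : κ → Bool) :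
    chi T (Sum.elim x y) = chi T.toLeft x * chi T.toRight y := by
  conv_lhs => rw [← Finset.toLeft_disjSum_toRight (u := T)]
  simp only [chi_eq_prod, Finset.prod_disjSum, Sum.elim_inl, Sum.elim_inr]

lemma sum_chi_mul_chi [Fintype ι] (x y : ι → Bool) :
    ∑ S : Finset ι, chi S x * chi S y = if x = y then 2 ^ Fintype.card ι else 0 := by
  classical
  have product_form : ∑ S : Finset ι, chi S x * chi S y =
      ∏ i, (1 + (-1) ^ (x i).toNat * (-1) ^ (y i).toNat) := by
    simp only [Finset.prod_one_add, Finset.powerset_univ, chi_eq_prod, Finset.prod_mul_distrib]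
  rw [product_form]
  split_ifs with hxy
  · have factor (b : Bool) : (1 + (-1) ^ b.toNat * (-1) ^ b.toNat : ℝ) = 2 := by
      cases b <;> norm_num
    simp only [hxy, factor, Finset.prod_const, Finset.card_univ]
  · obtain ⟨i, hi⟩ := Function.ne_iff.1 hxy
    refine Finset.prod_eq_zero (Finset.mem_univ i) ?_
    revert hi
    cases x i <;> cases y i <;> simp

lemma exists_chi_expansion [Finite ι] (g : (ι → Bool) → ℝ) :
    ∃ (𝒮 : Finset (Finset ι)) (c : Finset ι → ℝ), ∀ x, g x = ∑ S ∈ 𝒮, c S * chi S x := by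
  classical
  have := Fintype.ofFinite ι
  refine ⟨.univ, fun S => (∑ y, g y * chi S y) / 2 ^ Fintype.card ι, fun x => ?_⟩
  calc g x = (∑ y, g y * ∑ S, chi S y * chi S x) / 2 ^ Fintype.card ι := by
        simp [sum_chi_mul_chi]
    _ = ∑ S, (∑ y, g y * chi S y) / 2 ^ Fintype.card ι * chi S x := by
        simp only [Finset.mul_sum, Finset.sum_div, Finset.sum_mul]
        rw [Finset.sum_comm]
        refine Finset.sum_congr rfl fun S _ => Finset.sum_congr rfl fun y _ => by ring

lemma signRep_iff {f : BoolFun ι} {p : (ι → Bool) → ℝ} :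
    SignRep f p ↔ (∀ x, f x = 1 → 0 < p x) ∧ ∀ x, f x = -1 → p x < 0 := by
  rw [SignRep, ← forall_and]
  refine forall_congr' fun x => ?_
  obtain hf | hf := Int.units_eq_one_or (f x) <;>
    obtain hp | hp | hp := lt_trichotomy (p x) 0 <;>
    norm_num [hf, hp, hp.not_gt, Real.sign_of_neg, Real.sign_of_pos]

lemma SignRep.pos {f : BoolFun ι} {p : (ι → Bool) → ℝ} (h : SignRep f p) {x : ι → Bool}
    (hx : f x = 1) : 0 < p x :=
  (signRep_iff.1 h).1 x hx

lemma SignRep.neg {f : BoolFun ι} {p : (ι → Bool) → ℝ} (h : SignRep f p) {x : ι → Bool}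
    (hx : f x = -1) : p x < 0 :=
  (signRep_iff.1 h).2 x hx

lemma exists_card_eq_dns [Finite ι] (f : BoolFun ι) :
    ∃ 𝒮 : Finset (Finset ι), 𝒮.card = dns f ∧
      ∃ c : Finset ι → ℝ, SignRep f (fun x => ∑ S ∈ 𝒮, c S * chi S x) := by
  obtain ⟨𝒮, c, hc⟩ := exists_chi_expansion fun x => ((f x : ℤ) : ℝ)
  refine Nat.sInf_mem (s := {k | ∃ 𝒮 : Finset (Finset ι), 𝒮.card = k ∧ _})
    ⟨_, 𝒮, rfl, c, ?_⟩
  simp only [← hc]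
  exact signRep_iff.2 ⟨fun x hx => by simp [hx], fun x hx => by simp [hx]⟩

/-- If a single character represented `f ∧ g`, then on a rectangle the products of opposite corners
would agree, while the conjunction has exactly one corner of sign `-1`. -/
theorem two_le_dns_conj [Finite ι] [Finite κ] {f : BoolFun ι} {g : BoolFun κ}
    (hf : ∃ x, f x = -1) (hf' : ∃ x, f x = 1) (hg : ∃ y, g y = -1) (hg' : ∃ y, g y = 1) :
    2 ≤ dns (conj f g) := by
  obtain ⟨x, hx⟩ := hf
  obtain ⟨x', hx'⟩ := hf'
  obtain ⟨y, hy⟩ := hg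
  obtain ⟨y', hy'⟩ := hg'
  obtain ⟨𝒮, hcard, c, hc⟩ := exists_card_eq_dns (conj f g)
  by_contra! hlt
  have corner := hc.neg (x := Sum.elim x y) (by simp [conj, hx, hy])
  have corner₁ := hc.pos (x := Sum.elim x y') (by simp [conj, hx, hy'])
  have corner₂ := hc.pos (x := Sum.elim x' y) (by simp [conj, hx', hy])
  have corner₃ := hc.pos (x := Sum.elim x' y') (by simp [conj, hx', hy'])
  obtain hS | hS : 𝒮.card = 0 ∨ 𝒮.card = 1 := by lia
  · simp [Finset.card_eq_zero.1 hS] at corner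
  · obtain ⟨S, rfl⟩ := Finset.card_eq_one.1 hS
    simp only [Finset.sum_singleton, chi_sumElim] at corner corner₁ corner₂ corner₃
    nlinarith [mul_pos corner₁ corner₂, mul_neg_of_neg_of_pos corner corner₃]

end Characters

/-! ### Functions of low degree -/

section LowDegree

variable {ι κ : Type*} {d e : ℕ}

/-- The real functions of degree at most `d` on the Boolean cube. -/
def lowDeg (ι : Type*) (d : ℕ) : Submodule ℝ ((ι → Bool) → ℝ) :=
  Submodule.span ℝ (chi '' {S : Finset ι | S.card ≤ d})

lemma chi_mem_lowDeg {S : Finset ι} (h : S.card ≤ d) : chi S ∈ lowDeg ι d :=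
  Submodule.subset_span ⟨S, h, rfl⟩

lemma lowDeg_mono (h : d ≤ e) : lowDeg ι d ≤ lowDeg ι e :=
  Submodule.span_mono (Set.image_mono fun _ hS => le_trans hS h)

lemma one_mem_lowDeg (d : ℕ) : (1 : (ι → Bool) → ℝ) ∈ lowDeg ι d := by
  have : (1 : (ι → Bool) → ℝ) = chi ∅ := funext fun x => (chi_empty x).symm
  exact this ▸ chi_mem_lowDeg (by simp)

lemma const_mem_lowDeg (d : ℕ) (c : ℝ) : (fun _ => c) ∈ lowDeg ι d := by
  convert (lowDeg ι d).smul_mem c (one_mem_lowDeg d) using 1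
  ext x
  simp

lemma mul_mem_lowDeg {f g : (ι → Bool) → ℝ} (hf : f ∈ lowDeg ι d) (hg : g ∈ lowDeg ι e) :
    f * g ∈ lowDeg ι (d + e) := by
  classical
  have hfg := Submodule.mul_mem_mul hf hg
  rw [lowDeg, lowDeg, Submodule.span_mul_span] at hfg
  refine Submodule.span_mono ?_ hfg
  rintro _ ⟨_, ⟨S, hS, rfl⟩, _, ⟨T, hT, rfl⟩, rfl⟩
  refine ⟨symmDiff S T, ?_, funext fun x => (chi_mul_chi S T x).symm⟩
  calc (symmDiff S T).card ≤ (S ∪ T).card := Finset.card_le_card symmDiff_le_sup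
    _ ≤ S.card + T.card := Finset.card_union_le _ _
    _ ≤ d + e := add_le_add hS hT

lemma bit_mem_lowDeg (i : ι) : (fun x => bit x i) ∈ lowDeg ι 1 := by
  convert (lowDeg ι 1).smul_mem (1 / 2 : ℝ)
    ((lowDeg ι 1).sub_mem (one_mem_lowDeg 1) (chi_mem_lowDeg (S := {i}) (by simp))) using 1
  ext x
  cases hx : x i <;> norm_num [bit, chi, hx]

lemma eval_mem_lowDeg {g : (ι → Bool) → ℝ} (hg : g ∈ lowDeg ι 1) (R : ℝ[X]) :
    (fun x => R.eval (g x)) ∈ lowDeg ι R.natDegree := by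
  have pow_mem (k : ℕ) : g ^ k ∈ lowDeg ι k := by
    induction k with
    | zero => exact one_mem_lowDeg 0
    | succ k ih => exact pow_succ g k ▸ mul_mem_lowDeg ih hg
  have : (fun x => R.eval (g x)) = ∑ k ∈ Finset.range (R.natDegree + 1), R.coeff k • g ^ k := by
    ext x
    simp [eval_eq_sum_range]
  rw [this]
  exact sum_mem fun k hk => Submodule.smul_mem _ _
    (lowDeg_mono (Finset.mem_range_succ_iff.1 hk) (pow_mem k))

lemma comp_mem_lowDeg_of_chi {φ : (κ → Bool) → ι → Bool} {p : (ι → Bool) → ℝ}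
    (hp : p ∈ lowDeg ι d) (hφ : ∀ S : Finset ι, S.card ≤ d → chi S ∘ φ ∈ lowDeg κ d) :
    p ∘ φ ∈ lowDeg κ d := by
  suffices lowDeg ι d ≤ (lowDeg κ d).comap (LinearMap.funLeft ℝ ℝ φ) from this hp
  refine Submodule.span_le.2 ?_
  rintro _ ⟨S, hS, rfl⟩
  exact hφ S hS

lemma comp_sumElim_left_mem_lowDeg {p : (ι ⊕ κ → Bool) → ℝ} (hp : p ∈ lowDeg (ι ⊕ κ) d)
    (y : κ → Bool) : (fun x => p (Sum.elim x y)) ∈ lowDeg ι d := by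
  refine comp_mem_lowDeg_of_chi hp fun S hS => ?_
  convert (lowDeg ι d).smul_mem (chi S.toRight y)
    (chi_mem_lowDeg (S.card_toLeft_le.trans hS)) using 1
  ext x
  simp [chi_sumElim, mul_comm]

lemma comp_sumElim_right_mem_lowDeg {p : (ι ⊕ κ → Bool) → ℝ} (hp : p ∈ lowDeg (ι ⊕ κ) d)
    (x : ι → Bool) : (fun y => p (Sum.elim x y)) ∈ lowDeg κ d := by
  refine comp_mem_lowDeg_of_chi hp fun S hS => ?_
  convert (lowDeg κ d).smul_mem (chi S.toLeft x)
    (chi_mem_lowDeg (S.card_toRight_le.trans hS)) using 1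
  ext y
  simp [chi_sumElim]

end LowDegree

/-! ### From small density to low degree -/

section Lift

variable {B C ι κ : Type*}

/-- The contents of a block of four bits, indexed by a half and a position in it: the half `ρ`
carries `b` twice, the other half carries `a` and its negation. -/
def blockBit (ρ a b : Bool) (q : Bool × Bool) : Bool :=
  if q.1 = ρ then b else xor q.2 a

/-- The point of the cube whose blocks, located by `e`, have the contents
`blockBit (ρ i) (a i) (b i)` and whose other coordinates are those of `c`. -/
def fill (e : B × Bool × Bool ↪ ι) (c : ι → Bool) (ρ a b : B → Bool) : ι → Bool :=
  Function.extend e (fun q => blockBit (ρ q.1) (a q.1) (b q.1) q.2) c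

/-- `F` restricts to `f` along all fillings of some block structure. -/
def IsLift (F : BoolFun ι) (f : BoolFun B) : Prop :=
  ∃ (e : B × Bool × Bool ↪ ι) (c : ι → Bool), ∀ ρ a b, F (fill e c ρ a b) = f b

lemma fill_comp {E : C × Bool × Bool ↪ κ} {e : B × Bool × Bool ↪ ι} {φ : ι → κ} {ψ : B → C}
    {c' : κ → Bool} {c : ι → Bool} (he : ∀ q, E (ψ q.1, q.2) = φ (e q))
    (hc : ∀ j, c' (φ j) = c j) (hr : ∀ j, φ j ∈ Set.range E → j ∈ Set.range e)
    (ρ a b : C → Bool) : fill E c' ρ a b ∘ φ = fill e c (ρ ∘ ψ) (a ∘ ψ) (b ∘ ψ) := by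
  ext j
  by_cases hj : j ∈ Set.range e
  · obtain ⟨q, rfl⟩ := hj
    simp only [fill, Function.comp_apply, ← he, E.injective.extend_apply, e.injective.extend_apply]
  · simp only [fill, Function.comp_apply]
    rw [Function.extend_apply' _ _ _ hj, Function.extend_apply' _ _ _ fun h => hj (hr j h), hc]

lemma IsLift.conj {F : BoolFun ι} {f : BoolFun B} {G : BoolFun κ} {g : BoolFun C}
    (hF : IsLift F f) (hG : IsLift G g) : IsLift (conj F G) (conj f g) := by
  obtain ⟨e, c, hF⟩ := hF
  obtain ⟨e', c', hG⟩ := hG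
  let E := (Equiv.sumProdDistrib B C (Bool × Bool)).toEmbedding.trans (e.sumMap e')
  refine ⟨E, Sum.elim c c', fun ρ a b => ?_⟩
  have left : (fun i => fill E (Sum.elim c c') ρ a b (Sum.inl i)) =
      fill e c (ρ ∘ Sum.inl) (a ∘ Sum.inl) (b ∘ Sum.inl) :=
    fill_comp (fun _ => rfl) (fun _ => rfl) (by
      rintro j ⟨⟨i | i, q⟩, hq⟩
      · exact ⟨(i, q), Sum.inl.inj hq⟩
      · cases hq) ρ a b
  have right : (fun j => fill E (Sum.elim c c') ρ a b (Sum.inr j)) =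
      fill e' c' (ρ ∘ Sum.inr) (a ∘ Sum.inr) (b ∘ Sum.inr) :=
    fill_comp (fun _ => rfl) (fun _ => rfl) (by
      rintro j ⟨⟨i | i, q⟩, hq⟩
      · cases hq
      · exact ⟨(i, q), Sum.inr.inj hq⟩) ρ a b
  simp only [ThresholdDensity.conj, left, right, hF, hG]
  rfl

lemma chi_blockBit (m : Finset (Bool × Bool)) (ρ a b : Bool) :
    chi m (blockBit ρ a b) = chi m (blockBit ρ false false) *
      ((-1) ^ b.toNat) ^ {q ∈ m | q.1 = ρ}.card * ((-1) ^ a.toNat) ^ {q ∈ m | ¬q.1 = ρ}.card := by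
  have flip (q : Bool × Bool) : (-1 : ℝ) ^ (blockBit ρ a b q).toNat =
      (-1) ^ (blockBit ρ false false q).toNat *
        if q.1 = ρ then (-1) ^ b.toNat else (-1) ^ a.toNat := by
    obtain ⟨r, s⟩ := q
    cases r <;> cases s <;> cases ρ <;> cases a <;> cases b <;> norm_num [blockBit]
  simp only [chi_eq_prod, flip, Finset.prod_mul_distrib, Finset.prod_ite, Finset.prod_const,
    mul_assoc]

lemma sum_chi_blockBit (m : Finset (Bool × Bool)) (ρ b : Bool) :
    ∑ a, chi m (blockBit ρ a b) =
      (∑ a, chi m (blockBit ρ a false)) * ((-1) ^ b.toNat) ^ m.card := by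
  have hm := Finset.card_filter_add_card_filter_not (s := m) fun q => q.1 = ρ
  simp only [Fintype.sum_bool, chi_blockBit m ρ _ b, chi_blockBit m ρ true false, ← hm, pow_add]
  obtain h | h := Nat.even_or_odd {q ∈ m | ¬q.1 = ρ}.card <;>
    cases b <;> (simp [h.neg_one_pow]; try ring)

lemma sum_chi_blockBit_eq_zero {m : Finset (Bool × Bool)} {ρ : Bool}
    (h : Odd {q ∈ m | ¬q.1 = ρ}.card) (b : Bool) : ∑ a, chi m (blockBit ρ a b) = 0 := by
  simp [chi_blockBit m ρ _ b, h.neg_one_pow]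

/-- Exactly one half of an odd set is odd, and the sum over `a` vanishes unless `ρ` selects it. -/
lemma exists_half_sum_chi_blockBit_eq_zero (m : Finset (Bool × Bool)) :
    ∃ r : Bool, ∀ ρ b, Odd m.card → ρ ≠ r → ∑ a, chi m (blockBit ρ a b) = 0 := by
  refine ⟨decide (Odd {q ∈ m | q.1 = true}.card), fun ρ b hm hρ =>
    sum_chi_blockBit_eq_zero ?_ b⟩
  have hsplit := Finset.card_filter_add_card_filter_not (s := m) fun q => q.1 = ρ
  cases ρ
  · simpa using hρ
  · rw [← hsplit, Nat.odd_add] at hm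
    exact Nat.not_even_iff_odd.1 fun h => hρ (by simpa using hm.2 h)

lemma exists_chi_fill_eq_mul_prod [Fintype B] (e : B × Bool × Bool ↪ ι) (c : ι → Bool)
    (S : Finset ι) : ∃ (K : ℝ) (m : B → Finset (Bool × Bool)), ∀ ρ a b,
      chi S (fill e c ρ a b) = K * ∏ i, chi (m i) (blockBit (ρ i) (a i) (b i)) := by
  classical
  refine ⟨chi {j ∈ S | j ∉ Set.range e} c, fun i => {q | e (i, q) ∈ S}, fun ρ a b => ?_⟩
  have hinside : {j ∈ S | j ∈ Set.range e} = ({q | e q ∈ S} : Finset _).map e := by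
    ext j
    simp only [Finset.mem_filter, Set.mem_range, Finset.mem_map, Finset.mem_univ, true_and]
    exact ⟨fun ⟨hj, q, hq⟩ => ⟨q, hq ▸ hj, hq⟩, fun ⟨q, hq, hj⟩ => ⟨hj ▸ hq, q, hj⟩⟩
  rw [chi_eq_prod, ← Finset.prod_filter_not_mul_prod_filter S (· ∈ Set.range e), chi_eq_prod,
    hinside, Finset.prod_map, Finset.prod_filter (fun q => e q ∈ S), Fintype.prod_prod_type]
  congr 1
  · refine Finset.prod_congr rfl fun j hj => ?_
    rw [fill, Function.extend_apply' _ _ _ (Finset.mem_filter.1 hj).2]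
  · refine Finset.prod_congr rfl fun i _ => ?_
    simp only [fill, e.injective.extend_apply, chi_eq_prod, Finset.prod_filter]

lemma exists_sum_chi_fill_eq [Fintype B] [DecidableEq B] (e : B × Bool × Bool ↪ ι)
    (c : ι → Bool) (S : Finset ι) :
    ∃ (O : Finset B) (r : B → Bool) (k : (B → Bool) → ℝ),
      (∀ ρ b, ∑ a : B → Bool, chi S (fill e c ρ a b) = k ρ * chi O b) ∧
      ∀ ρ, (∃ i ∈ O, ρ i ≠ r i) → k ρ = 0 := by
  obtain ⟨K, m, hm⟩ := exists_chi_fill_eq_mul_prod e c S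
  choose r hr using fun i => exists_half_sum_chi_blockBit_eq_zero (m i)
  refine ⟨Finset.univ.filter fun i => Odd (m i).card, r,
    fun ρ => K * ∏ i, ∑ a, chi (m i) (blockBit (ρ i) a false), fun ρ b => ?_, ?_⟩
  · have parity : chi (Finset.univ.filter fun i => Odd (m i).card) b =
        ∏ i, ((-1) ^ (b i).toNat) ^ (m i).card := by
      rw [chi_eq_prod, Finset.prod_filter]
      refine Finset.prod_congr rfl fun i _ => ?_
      obtain h | h := Nat.even_or_odd (m i).card <;> cases b i <;>
        simp [h, h.neg_one_pow]
    calc ∑ a, chi S (fill e c ρ a b)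
        = K * ∏ i, ∑ a, chi (m i) (blockBit (ρ i) a (b i)) := by
          simp only [hm, ← Finset.mul_sum, Fintype.prod_sum]
      _ = _ := by
          simp only [sum_chi_blockBit _ _ (b _), Finset.prod_mul_distrib, parity, mul_assoc]
  · rintro ρ ⟨i, hi, hρ⟩
    have hodd : Odd (m i).card := (Finset.mem_filter.1 hi).2
    exact mul_eq_zero_of_right K
      (Finset.prod_eq_zero (Finset.mem_univ i) (hr i (ρ i) false hodd hρ))

lemma card_agree_mul_two_pow [Fintype B] [DecidableEq B] (O : Finset B) (r : B → Bool) :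
    (Finset.univ.filter fun ρ : B → Bool => ∀ i ∈ O, ρ i = r i).card * 2 ^ O.card =
      2 ^ Fintype.card B := by
  have hpi : (Finset.univ.filter fun ρ : B → Bool => ∀ i ∈ O, ρ i = r i) =
      Fintype.piFinset fun i => if i ∈ O then {r i} else .univ := by
    ext ρ
    simp only [Finset.mem_filter, Finset.mem_univ, true_and, Fintype.mem_piFinset]
    refine forall_congr' fun i => ?_
    split_ifs with h <;> simp [h]
  have hcard (i : B) : (if i ∈ O then ({r i} : Finset Bool) else .univ).card =
      if i ∈ Oᶜ then 2 else 1 := by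
    by_cases h : i ∈ O <;> simp [h]
  rw [hpi, Fintype.card_piFinset]
  simp only [hcard, Finset.prod_ite_mem, Finset.univ_inter, Finset.prod_const]
  rw [← pow_add, Finset.card_compl_add_card]

lemma exists_forall_exists_ne_of_card_lt {α : Type*} [Finite B] {𝒮 : Finset α} {d : ℕ}
    (h𝒮 : 𝒮.card < 2 ^ d) (O : α → Finset B) (r : α → B → Bool) :
    ∃ ρ : B → Bool, ∀ S ∈ 𝒮, d ≤ (O S).card → ∃ i ∈ O S, ρ i ≠ r S i := by
  classical
  have := Fintype.ofFinite B
  by_contra! hcon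
  let bad (S : α) : Finset (B → Bool) := {ρ | ∀ i ∈ O S, ρ i = r S i}
  have cover : Finset.univ ⊆ {S ∈ 𝒮 | d ≤ (O S).card}.biUnion bad := fun ρ _ => by
    obtain ⟨S, hS, hd, hρ⟩ := hcon ρ
    exact Finset.mem_biUnion.2 ⟨S, Finset.mem_filter.2 ⟨hS, hd⟩, by simpa [bad] using hρ⟩
  have : 2 ^ Fintype.card B * 2 ^ d < 2 ^ Fintype.card B * 2 ^ d := calc
    2 ^ Fintype.card B * 2 ^ d
        ≤ (∑ S ∈ 𝒮 with d ≤ (O S).card, (bad S).card) * 2 ^ d := by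
          gcongr
          simpa using (Finset.card_le_card cover).trans Finset.card_biUnion_le
    _ ≤ ∑ S ∈ 𝒮 with d ≤ (O S).card, 2 ^ Fintype.card B := by
          rw [Finset.sum_mul]
          refine Finset.sum_le_sum fun S hS => ?_
          rw [← card_agree_mul_two_pow (O S) (r S)]
          gcongr
          · norm_num
          · exact (Finset.mem_filter.1 hS).2
    _ ≤ 𝒮.card * 2 ^ Fintype.card B := by
          rw [Finset.sum_const, smul_eq_mul]
          gcongr
          exact Finset.filter_subset _ _
    _ < 2 ^ Fintype.card B * 2 ^ d := by
          rw [mul_comm]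
          gcongr
  exact this.false

theorem exists_lowDeg_signRep_of_dns_lt [Finite B] [Finite ι] {F : BoolFun ι} {f : BoolFun B}
    (hF : IsLift F f) {d : ℕ} (hd : dns F < 2 ^ d) : ∃ p ∈ lowDeg B d, SignRep f p := by
  classical
  have := Fintype.ofFinite B
  obtain ⟨e, c, hlift⟩ := hF
  obtain ⟨𝒮, hcard, l, hl⟩ := exists_card_eq_dns F
  choose O r k hk hk0 using fun S => exists_sum_chi_fill_eq e c S
  obtain ⟨ρ, hρ⟩ := exists_forall_exists_ne_of_card_lt (hcard ▸ hd) O r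
  refine ⟨fun b => ∑ a, ∑ S ∈ 𝒮, l S * chi S (fill e c ρ a b), ?_, signRep_iff.2 ⟨?_, ?_⟩⟩
  · have average : (fun b => ∑ a, ∑ S ∈ 𝒮, l S * chi S (fill e c ρ a b)) =
        ∑ S ∈ 𝒮, (l S * k S ρ) • chi (O S) := by
      ext b
      rw [Finset.sum_comm]
      simp only [← Finset.mul_sum, hk, Finset.sum_apply, Pi.smul_apply, smul_eq_mul, mul_assoc]
    rw [average]
    refine sum_mem fun S hS => ?_
    obtain h | h := le_or_gt d (O S).card
    · simp [hk0 S ρ (hρ S hS h)]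
    · exact Submodule.smul_mem _ _ (chi_mem_lowDeg h.le)
  · exact fun b hb => Finset.sum_pos (fun a _ => hl.pos (by rw [hlift, hb])) Finset.univ_nonempty
  · exact fun b hb => Finset.sum_neg (fun a _ => hl.neg (by rw [hlift, hb])) Finset.univ_nonempty

end Lift

/-! ### Random subset sums -/

section SubsetSum

variable {ι : Type*} [Fintype ι] {M : ℕ}

/-- The sum modulo `M` of the weights selected by `x`. -/
def modSum (w : ι → ZMod M) (x : ι → Bool) : ZMod M :=
  ∑ i, if x i then w i else 0

/-- The indicator of the residue class `modSum w x = t`, recentred by its expected value `1 / M`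
under random weights. -/
def classDeviation (w : ι → ZMod M) (t : ZMod M) (x : ι → Bool) : ℝ :=
  (if modSum w x = t then 1 else 0) - 1 / M

lemma classDeviation_sq (w : ι → ZMod M) (t : ZMod M) (x : ι → Bool) :
    classDeviation w t x ^ 2 = classDeviation w t x * (1 - 2 / M) + 1 / M * (1 - 1 / M) := by
  unfold classDeviation
  split_ifs <;> ring

lemma classDeviation_sq_le_one [NeZero M] (w : ι → ZMod M) (t : ZMod M) (x : ι → Bool) :
    classDeviation w t x ^ 2 ≤ 1 := by
  have hM : (1 / M : ℝ) ≤ 1 := div_le_one_of_le₀ (mod_cast NeZero.one_le) (by positivity)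
  have hM₀ : 0 ≤ (1 / M : ℝ) := by positivity
  refine (sq_le_one_iff_abs_le_one _).2 (abs_le.2 ?_)
  unfold classDeviation
  split_ifs <;> constructor <;> linarith

variable [DecidableEq ι]

lemma modSum_add_single (w : ι → ZMod M) (i : ι) (c : ZMod M) (x : ι → Bool) :
    modSum (w + Pi.single i c) x = modSum w x + if x i then c else 0 := by
  have term (j : ι) : (if x j then (w + Pi.single i c : ι → ZMod M) j else 0) =
      (if x j then w j else 0) + if j = i then (if x i then c else 0) else 0 := by
    obtain rfl | hj := eq_or_ne j i
    · cases x j <;> simp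
    · simp [hj]
  simp only [modSum, term, Finset.sum_add_distrib, Finset.sum_ite_eq', Finset.mem_univ, if_true]

lemma classDeviation_add_single (w : ι → ZMod M) (t : ZMod M) {x : ι → Bool}
    {i : ι} (hi : x i = false) (c : ZMod M) :
    classDeviation (w + Pi.single i c) t x = classDeviation w t x := by
  simp [classDeviation, modSum_add_single, hi]

variable [NeZero M]

lemma sum_classDeviation_add_single (w : ι → ZMod M) (t : ZMod M) {x : ι → Bool}
    {i : ι} (hi : x i = true) : ∑ c : ZMod M, classDeviation (w + Pi.single i c) t x = 0 := by
  have solve (c : ZMod M) : modSum w x + c = t ↔ c = t - modSum w x := by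
    rw [eq_sub_iff_add_eq, add_comm]
  have hM : (M : ℝ) ≠ 0 := NeZero.ne _
  simp [classDeviation, modSum_add_single, hi, solve, ZMod.card, hM]

lemma sum_eq_zero_of_sum_add_single_eq_zero {F : (ι → ZMod M) → ℝ} (i : ι)
    (h : ∀ w : ι → ZMod M, ∑ c, F (w + Pi.single i c) = 0) : ∑ w, F w = 0 := by
  have translate (c : ZMod M) : ∑ w : ι → ZMod M, F (w + Pi.single i c) = ∑ w, F w :=
    Equiv.sum_comp (Equiv.addRight (Pi.single i c : ι → ZMod M)) F
  have average : ∑ c : ZMod M, ∑ w : ι → ZMod M, F (w + Pi.single i c) = 0 := by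
    rw [Finset.sum_comm]
    exact Finset.sum_eq_zero fun w _ => h w
  simpa [translate, ZMod.card, NeZero.ne M] using average

lemma sum_classDeviation_mul_classDeviation (t : ZMod M) {x y : ι → Bool} (h : x ≠ y) :
    ∑ w, classDeviation w t x * classDeviation w t y = 0 := by
  wlog hxy : ∃ i, x i = true ∧ y i = false generalizing x y
  · simp only [mul_comm (classDeviation _ t x)]
    refine this h.symm ?_
    obtain ⟨i, hi⟩ := Function.ne_iff.1 h
    exact ⟨i, by grind⟩
  obtain ⟨i, hx, hy⟩ := hxy
  refine sum_eq_zero_of_sum_add_single_eq_zero i fun w => ?_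
  simp only [classDeviation_add_single w t hy, ← Finset.sum_mul,
    sum_classDeviation_add_single w t hx, zero_mul]

lemma sum_classDeviation_sq_le (t : ZMod M) {x : ι → Bool} (h : ∃ i, x i = true) :
    ∑ w, classDeviation w t x ^ 2 ≤ Fintype.card (ι → ZMod M) * (1 / M : ℝ) := by
  obtain ⟨i, hi⟩ := h
  have mean_zero : ∑ w, classDeviation w t x = 0 :=
    sum_eq_zero_of_sum_add_single_eq_zero i fun w => sum_classDeviation_add_single w t hi
  simp only [classDeviation_sq, Finset.sum_add_distrib, ← Finset.sum_mul, mean_zero, zero_mul,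
    zero_add, Finset.sum_const, nsmul_eq_mul, Finset.card_univ]
  exact mul_le_of_le_one_right (by positivity) (sub_le_self _ (by positivity))

lemma sum_sq_sum_chi_mul_classDeviation_le (t : ZMod M) (S : Finset ι) :
    ∑ w : ι → ZMod M, (∑ x, chi S x * classDeviation w t x) ^ 2 ≤
      Fintype.card (ι → ZMod M) * (2 ^ Fintype.card ι / M + 1 : ℝ) := by
  set N := (Fintype.card (ι → ZMod M) : ℝ)
  have diagonal : ∑ w : ι → ZMod M, (∑ x, chi S x * classDeviation w t x) ^ 2 =
      ∑ x, ∑ w : ι → ZMod M, classDeviation w t x ^ 2 := by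
    simp only [sq, Finset.sum_mul_sum]
    rw [Finset.sum_comm]
    refine Finset.sum_congr rfl fun x _ => ?_
    rw [Finset.sum_comm, Finset.sum_eq_single x]
    · refine Finset.sum_congr rfl fun w _ => ?_
      linear_combination classDeviation w t x ^ 2 * chi_mul_self S x
    · intro y _ hy
      simp only [mul_mul_mul_comm _ (classDeviation _ t x), ← Finset.mul_sum,
        sum_classDeviation_mul_classDeviation t hy.symm, mul_zero]
    · simp
  have pointwise (x : ι → Bool) : ∑ w : ι → ZMod M, classDeviation w t x ^ 2 ≤
      N * (1 / M : ℝ) + if x = fun _ => false then N else 0 := by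
    split_ifs with hx
    · refine le_add_of_nonneg_of_le (by positivity) ?_
      simpa [N] using Finset.sum_le_card_nsmul Finset.univ _ 1 fun w _ =>
        classDeviation_sq_le_one w t x
    · obtain ⟨i, hi⟩ := Function.ne_iff.1 hx
      rw [add_zero]
      exact sum_classDeviation_sq_le t ⟨i, by simpa using hi⟩
  calc _ ≤ ∑ x : ι → Bool, (N * (1 / M : ℝ) + if x = fun _ => false then N else 0) :=
        diagonal ▸ Finset.sum_le_sum fun x _ => pointwise x
    _ = _ := by
        simp [Finset.sum_add_distrib]
        ring

lemma exists_weights_small_bias (𝒟 : Finset (Finset ι)) :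
    ∃ w : ι → ZMod M, ∀ t, ∀ S ∈ 𝒟, (∑ x, chi S x * classDeviation w t x) ^ 2 ≤
      𝒟.card * (2 ^ Fintype.card ι + M : ℝ) := by
  have hM : (0 : ℝ) < M := mod_cast NeZero.pos M
  let bias (w : ι → ZMod M) (t : ZMod M) (S : Finset ι) : ℝ :=
    (∑ x, chi S x * classDeviation w t x) ^ 2
  have average : ∑ w, ∑ t, ∑ S ∈ 𝒟, bias w t S ≤
      ∑ _w : ι → ZMod M, (𝒟.card * (2 ^ Fintype.card ι + M) : ℝ) := calc
    _ = ∑ t, ∑ S ∈ 𝒟, ∑ w, bias w t S := by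
        rw [Finset.sum_comm]
        exact Finset.sum_congr rfl fun t _ => Finset.sum_comm
    _ ≤ ∑ _t : ZMod M, ∑ _S ∈ 𝒟,
          (Fintype.card (ι → ZMod M) * (2 ^ Fintype.card ι / M + 1 : ℝ)) :=
        Finset.sum_le_sum fun t _ => Finset.sum_le_sum fun S _ =>
          sum_sq_sum_chi_mul_classDeviation_le t S
    _ = _ := by
        simp only [Finset.sum_const, Finset.card_univ, ZMod.card, nsmul_eq_mul]
        field_simp
  obtain ⟨w, _, hw⟩ := Finset.exists_le_of_sum_le Finset.univ_nonempty average
  refine ⟨w, fun t S hS => le_trans ?_ hw⟩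
  calc bias w t S ≤ ∑ S ∈ 𝒟, bias w t S :=
        Finset.single_le_sum (f := bias w t) (fun S _ => sq_nonneg _) hS
    _ ≤ ∑ t, ∑ S ∈ 𝒟, bias w t S :=
        Finset.single_le_sum (f := fun t => ∑ S ∈ 𝒟, bias w t S)
          (fun t _ => Finset.sum_nonneg fun S _ => sq_nonneg _) (Finset.mem_univ t)

end SubsetSum

/-! ### Measures annihilating characters -/

section Gordan

variable {α κ : Type*} [Fintype κ]

/-- Gordan's alternative, for probability vectors carried by `Y`. -/
theorem exists_mem_stdSimplex_or_exists_forall_pos [Fintype α] (Y : Finset α) (g : κ → α → ℝ) :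
    (∃ ν ∈ stdSimplex ℝ α, (∀ x ∉ Y, ν x = 0) ∧ ∀ k, ∑ x, ν x * g k x = 0) ∨
      ∃ a : κ → ℝ, ∀ x ∈ Y, 0 < ∑ k, a k * g k x := by
  classical
  let K : Set (α → ℝ) := stdSimplex ℝ α ∩ {ν | ∀ x ∉ Y, ν x = 0}
  let Φ : (α → ℝ) →ₗ[ℝ] (κ → ℝ) := Matrix.mulVecLin (Matrix.of g)
  have hΦ (ν : α → ℝ) (k : κ) : Φ ν k = ∑ x, ν x * g k x := by
    simp [Φ, Matrix.mulVec, dotProduct, mul_comm]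
  have hK_compact : IsCompact K := (isCompact_stdSimplex ℝ α).inter_right (by
    simp only [Set.ofPred_forall]
    exact isClosed_iInter fun x => isClosed_iInter fun _ =>
      isClosed_eq (continuous_apply x) continuous_const)
  have hK_convex : Convex ℝ K := (convex_stdSimplex ℝ α).inter
    fun ν hν ν' hν' s t _ _ _ x hx => by simp [hν x hx, hν' x hx]
  by_cases h0 : (0 : κ → ℝ) ∈ Φ '' K
  · obtain ⟨ν, ⟨hν, hνY⟩, hν0⟩ := h0
    exact .inl ⟨ν, hν, hνY, fun k => hΦ ν k ▸ congrFun hν0 k⟩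
  · right
    obtain ⟨f, u, hu, hf⟩ := geometric_hahn_banach_point_closed (hK_convex.linear_image Φ)
      (hK_compact.image Φ.continuous_of_finiteDimensional).isClosed h0
    refine ⟨fun k => f (Pi.single k 1), fun x hx => ?_⟩
    have hxK : Pi.single x 1 ∈ K :=
      ⟨single_mem_stdSimplex ℝ x, fun y hy => Pi.single_eq_of_ne (by grind) _⟩
    calc 0 = f 0 := (map_zero f).symm
      _ < f (Φ (Pi.single x 1)) := hu.trans (hf _ ⟨_, hxK, rfl⟩)
      _ = ∑ k, Φ (Pi.single x 1) k • f (Pi.single k 1) := by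
          simp only [← map_smul, ← map_sum, ← pi_eq_sum_univ']
      _ = ∑ k, f (Pi.single k 1) * g k x := by
          simp [hΦ, Pi.single_apply, mul_comm]

variable {Y : Finset α} {g : κ → α → ℝ} {δ μ : ℝ}

lemma sum_le_of_abs_sum_le (hδ : ∀ k, |∑ x ∈ Y, g k x| ≤ δ) (a : κ → ℝ) :
    ∑ x ∈ Y, ∑ k, a k * g k x ≤ (∑ k, |a k|) * δ := by
  rw [Finset.sum_comm, Finset.sum_mul]
  refine Finset.sum_le_sum fun k _ => ?_
  rw [← Finset.mul_sum]
  calc a k * ∑ x ∈ Y, g k x ≤ |a k| * |∑ x ∈ Y, g k x| := by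
        rw [← abs_mul]
        exact le_abs_self _
    _ ≤ |a k| * δ := by gcongr; exact hδ k

lemma le_sum_sq_of_almost_orthogonal [DecidableEq κ]
    (hμ : ∀ k l, |∑ x ∈ Y, g k x * g l x - if k = l then μ else 0| ≤ δ) (a : κ → ℝ) :
    μ * ∑ k, a k ^ 2 - (∑ k, |a k|) ^ 2 * δ ≤ ∑ x ∈ Y, (∑ k, a k * g k x) ^ 2 := by
  have expand : ∑ x ∈ Y, (∑ k, a k * g k x) ^ 2 =
      ∑ k, ∑ l, a k * a l * ∑ x ∈ Y, g k x * g l x := by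
    simp only [sq, Finset.sum_mul_sum]
    simp only [Finset.mul_sum]
    rw [Finset.sum_comm]
    refine Finset.sum_congr rfl fun k _ => ?_
    rw [Finset.sum_comm]
    exact Finset.sum_congr rfl fun l _ => Finset.sum_congr rfl fun x _ => by ring
  have main_term : μ * ∑ k, a k ^ 2 = ∑ k, ∑ l, a k * a l * if k = l then μ else 0 := by
    simp only [mul_ite, mul_zero, Finset.sum_ite_eq, Finset.mem_univ, if_true, Finset.mul_sum]
    exact Finset.sum_congr rfl fun k _ => by ring
  rw [expand, main_term, sq, Finset.sum_mul_sum, Finset.sum_mul, ← Finset.sum_sub_distrib]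
  refine Finset.sum_le_sum fun k _ => ?_
  rw [Finset.sum_mul, ← Finset.sum_sub_distrib]
  refine Finset.sum_le_sum fun l _ => ?_
  have error := neg_abs_le (a k * a l * (∑ x ∈ Y, g k x * g l x - if k = l then μ else 0))
  rw [abs_mul, abs_mul] at error
  have := mul_le_mul_of_nonneg_left (hμ k l) (by positivity : 0 ≤ |a k| * |a l|)
  linarith

/-- If no such measure exists, Gordan's alternative provides a combination `p` of the `g k` positive
on `Y`. As `p` is almost orthogonal to constants, `∑ p` is small; as `p` is bounded, so is `∑ p²`,
contradicting the almost orthogonality of the `g k`. -/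
theorem exists_mem_stdSimplex_of_almost_orthogonal [Fintype α] [DecidableEq κ]
    (hY : Y.Nonempty) (hg : ∀ k x, |g k x| ≤ 1) (hδ : ∀ k, |∑ x ∈ Y, g k x| ≤ δ)
    (hμ : ∀ k l, |∑ x ∈ Y, g k x * g l x - if k = l then μ else 0| ≤ δ)
    (hκ : 2 * δ * Fintype.card κ < μ) :
    ∃ ν ∈ stdSimplex ℝ α, (∀ x ∉ Y, ν x = 0) ∧ ∀ k, ∑ x, ν x * g k x = 0 := by
  refine (exists_mem_stdSimplex_or_exists_forall_pos Y g).resolve_right ?_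
  rintro ⟨a, ha⟩
  set p : α → ℝ := fun x => ∑ k, a k * g k x
  set A : ℝ := ∑ k, |a k|
  obtain ⟨k₀, hk₀⟩ : ∃ k, a k ≠ 0 := by
    by_contra! h
    obtain ⟨x, hx⟩ := hY
    simpa [h] using ha x hx
  have hδ₀ : 0 ≤ δ := (abs_nonneg _).trans (hδ k₀)
  have hp (x : α) : p x ≤ A := Finset.sum_le_sum fun k _ => calc
    a k * g k x ≤ |a k| * |g k x| := (le_abs_self _).trans (abs_mul _ _).le
    _ ≤ |a k| := mul_le_of_le_one_right (abs_nonneg _) (hg k x)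
  have : 0 ≤ A := Finset.sum_nonneg fun _ _ => abs_nonneg _
  have upper : ∑ x ∈ Y, p x ^ 2 ≤ A ^ 2 * δ := calc
    ∑ x ∈ Y, p x ^ 2 ≤ ∑ x ∈ Y, A * p x := Finset.sum_le_sum fun x hx => by
        rw [sq]
        exact mul_le_mul_of_nonneg_right (hp x) (ha x hx).le
    _ = A * ∑ x ∈ Y, p x := (Finset.mul_sum _ _ _).symm
    _ ≤ A * (A * δ) := by gcongr; exact sum_le_of_abs_sum_le hδ a
    _ = A ^ 2 * δ := by ring
  have cauchy_schwarz : A ^ 2 ≤ Fintype.card κ * ∑ k, a k ^ 2 := by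
    simpa only [sq_abs, Finset.card_univ] using
      sq_sum_le_card_mul_sum_sq (s := Finset.univ) (f := fun k => |a k|)
  have sum_sq_pos : 0 < ∑ k, a k ^ 2 :=
    Finset.sum_pos' (fun _ _ => sq_nonneg _) ⟨k₀, Finset.mem_univ _, by positivity⟩
  have lower : μ * ∑ k, a k ^ 2 ≤ 2 * δ * Fintype.card κ * ∑ k, a k ^ 2 := by
    have := le_sum_sq_of_almost_orthogonal hμ a
    have := mul_le_mul_of_nonneg_left cauchy_schwarz hδ₀
    linarith
  exact absurd (le_of_mul_le_mul_right lower sum_sq_pos) hκ.not_ge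

end Gordan

section Fooling

lemma card_filter_card_le_two_mul_le {ι : Type*} [Fintype ι] {q : ℕ}
    (hι : Fintype.card ι = 64 * q) :
    ((Finset.univ.filter fun S : Finset ι => S.card ≤ 2 * q).card : ℝ) ≤ 2 ^ (14 * q) := by
  have binomial := Finset.sum_pow_mul_eq_add_pow (1 / 16 : ℝ) 1 (Finset.univ : Finset ι)
  simp only [one_pow, mul_one, Finset.powerset_univ, Finset.card_univ, hι] at binomial
  refine le_of_mul_le_mul_right (a := (1 / 16 : ℝ) ^ (2 * q)) ?_ (by positivity)
  calc _ ≤ ∑ S : Finset ι with S.card ≤ 2 * q, (1 / 16 : ℝ) ^ S.card := by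
        rw [← nsmul_eq_mul]
        exact Finset.card_nsmul_le_sum _ _ _ fun S hS =>
          pow_le_pow_of_le_one (by norm_num) (by norm_num) (Finset.mem_filter.1 hS).2
    _ ≤ ∑ S : Finset ι, (1 / 16 : ℝ) ^ S.card :=
        Finset.sum_le_sum_of_subset_of_nonneg (Finset.filter_subset _ _)
          fun _ _ _ => by positivity
    _ = ((1 / 16 + 1) ^ 64) ^ q := by rw [binomial, pow_mul]
    _ ≤ (2 ^ 14 * (1 / 16) ^ 2) ^ q := by gcongr; norm_num
    _ = 2 ^ (14 * q) * (1 / 16) ^ (2 * q) := by rw [mul_pow, ← pow_mul, ← pow_mul]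

variable {ι : Type*} [Fintype ι] [DecidableEq ι] {q : ℕ}

/-- A probability vector on the cube that no nontrivial character of degree at most `q`
distinguishes from the uniform one. -/
structure IsWiseUniform (q : ℕ) (ν : (ι → Bool) → ℝ) : Prop where
  mem_stdSimplex : ν ∈ stdSimplex ℝ (ι → Bool)
  sum_mul_chi : ∀ S : Finset ι, S.Nonempty → S.card ≤ q → ∑ x, ν x * chi S x = 0

lemma exists_isWiseUniform_of_small_bias {Y : Finset (ι → Bool)} {μ δ : ℝ}
    (hδ : 2 * δ * (Finset.univ.filter fun S : Finset ι => S.card ≤ 2 * q).card < μ)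
    (hbias : ∀ S : Finset ι, S.card ≤ 2 * q → |∑ x ∈ Y, chi S x - if S = ∅ then μ else 0| ≤ δ) :
    ∃ ν, IsWiseUniform q ν ∧ ∀ x ∉ Y, ν x = 0 := by
  set D := (Finset.univ.filter fun S : Finset ι => S.card ≤ 2 * q).card
  have hδ₀ : 0 ≤ δ := (abs_nonneg _).trans (hbias ∅ (by simp))
  have hY : Y.Nonempty := by
    have hD : (1 : ℝ) ≤ D := mod_cast Finset.card_pos.2 ⟨∅, by simp⟩
    by_contra! h
    have hμδ := (le_abs_self μ).trans (by simpa [h] using hbias ∅ (by simp))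
    nlinarith
  let κ := {S : Finset ι // S.Nonempty ∧ S.card ≤ q}
  have hκ : (Fintype.card κ : ℝ) ≤ D := by
    rw [Fintype.card_subtype]
    exact_mod_cast Finset.card_le_card (Finset.monotone_filter_right Finset.univ
      fun (S : Finset ι) _ (hS : S.Nonempty ∧ S.card ≤ q) => hS.2.trans (by lia))
  obtain ⟨ν, hν, hνY, hchi⟩ := exists_mem_stdSimplex_of_almost_orthogonal (Y := Y)
    (g := fun S : κ => chi S.1) hY (fun S x => (abs_chi S.1 x).le)
    (fun S => by simpa [S.2.1.ne_empty] using hbias S.1 (S.2.2.trans (by lia)))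
    (fun S T => by
      have hcard : (symmDiff S.1 T.1).card ≤ 2 * q := calc
        _ ≤ (S.1 ∪ T.1).card := Finset.card_le_card symmDiff_le_sup
        _ ≤ S.1.card + T.1.card := Finset.card_union_le _ _
        _ ≤ 2 * q := by linarith [S.2.2, T.2.2]
      simpa only [chi_mul_chi, ← Finset.bot_eq_empty, symmDiff_eq_bot, Subtype.coe_inj] using
        hbias _ hcard)
    (lt_of_le_of_lt (by gcongr) hδ)
  exact ⟨ν, ⟨hν, fun S hS hSq => hchi ⟨S, hS, hSq⟩⟩, hνY⟩

lemma sum_chi_eq_zero {S : Finset ι} (hS : S.Nonempty) : ∑ x, chi S x = 0 := by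
  obtain ⟨i, hi⟩ := hS
  have product_form : ∑ x, chi S x = ∏ i, ∑ b : Bool, if i ∈ S then (-1) ^ b.toNat else 1 := by
    simp only [Fintype.prod_sum, chi_eq_prod, Finset.prod_ite_mem, Finset.univ_inter]
  rw [product_form]
  exact Finset.prod_eq_zero (Finset.mem_univ i) (by simp [hi])

lemma sum_chi_mul_classDeviation {M : ℕ} (w : ι → ZMod M) (t : ZMod M)
    (S : Finset ι) : ∑ x, chi S x * classDeviation w t x =
      ∑ x with modSum w x = t, chi S x - if S = ∅ then 2 ^ Fintype.card ι / (M : ℝ) else 0 := by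
  simp only [classDeviation, mul_sub, Finset.sum_sub_distrib, mul_ite, mul_one, mul_zero,
    Finset.sum_filter, ← Finset.sum_mul]
  congr 1
  split_ifs with hS
  · simp [hS, chi_empty, div_eq_mul_inv]
  · rw [sum_chi_eq_zero (Finset.nonempty_iff_ne_empty.2 hS), zero_mul]

theorem exists_weights_forall_exists_isWiseUniform (hq : 1 ≤ q) (hι : Fintype.card ι = 64 * q) :
    ∃ w : ι → ZMod (2 ^ q), ∀ t, ∃ ν, IsWiseUniform q ν ∧ ∀ x, modSum w x ≠ t → ν x = 0 := by
  have hD := card_filter_card_le_two_mul_le hι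
  set 𝒟 : Finset (Finset ι) := {S | S.card ≤ 2 * q}
  obtain ⟨w, hw⟩ := exists_weights_small_bias (ι := ι) (M := 2 ^ q) 𝒟
  refine ⟨w, fun t => ?_⟩
  have bias_le (S : Finset ι) (hS : S ∈ 𝒟) :
      |∑ x, chi S x * classDeviation w t x| ≤ 2 ^ (44 * q) := by
    refine abs_le_of_sq_le_sq ((hw t S hS).trans ?_) (by positivity)
    have : (2 : ℝ) ^ q ≤ 2 ^ (64 * q) := pow_le_pow_right₀ (by norm_num) (by lia)
    calc (𝒟.card * (2 ^ Fintype.card ι + (2 ^ q : ℕ)) : ℝ)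
        ≤ 2 ^ (14 * q) * (2 ^ (64 * q) + 2 ^ (64 * q)) := by
          rw [hι, Nat.cast_pow, Nat.cast_two]
          gcongr
      _ = 2 ^ (14 * q + (64 * q + 1)) := by ring
      _ ≤ 2 ^ (44 * q * 2) := pow_le_pow_right₀ (by norm_num) (by lia)
      _ = (2 ^ (44 * q)) ^ 2 := pow_mul _ _ _
  obtain ⟨ν, hν, hνt⟩ := exists_isWiseUniform_of_small_bias (q := q)
    (Y := {x | modSum w x = t}) (μ := 2 ^ Fintype.card ι / (2 ^ q : ℕ)) (δ := 2 ^ (44 * q)) (by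
      rw [lt_div_iff₀ (by positivity), hι]
      calc 2 * 2 ^ (44 * q) * (𝒟.card : ℝ) * (2 ^ q : ℕ)
          ≤ 2 * 2 ^ (44 * q) * 2 ^ (14 * q) * 2 ^ q := by
            rw [Nat.cast_pow, Nat.cast_two]
            gcongr
        _ = 2 ^ (1 + 44 * q + 14 * q + q) := by ring
        _ < 2 ^ (64 * q) := pow_lt_pow_right₀ (by norm_num) (by lia)) fun S hS => by
      rw [← sum_chi_mul_classDeviation]
      exact bias_le S (by simpa [𝒟] using hS)
  exact ⟨ν, hν, fun x hx => hνt x (by simpa using hx)⟩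

lemma IsWiseUniform.sum_mul_eq {ν ν' g : (ι → Bool) → ℝ} (hν : IsWiseUniform q ν)
    (hν' : IsWiseUniform q ν') (hg : g ∈ lowDeg ι q) : ∑ x, ν x * g x = ∑ x, ν' x * g x := by
  induction hg using Submodule.span_induction with
  | mem _ hS =>
    obtain ⟨S, hS, rfl⟩ := hS
    rcases S.eq_empty_or_nonempty with rfl | hne
    · simp only [chi_empty, mul_one, hν.mem_stdSimplex.2, hν'.mem_stdSimplex.2]
    · rw [hν.sum_mul_chi S hne hS, hν'.sum_mul_chi S hne hS]
  | zero => simp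
  | add _ _ _ _ ha hb => simp only [Pi.add_apply, mul_add, Finset.sum_add_distrib, ha, hb]
  | smul r _ _ ha =>
    simp only [Pi.smul_apply, smul_eq_mul, mul_left_comm _ r, ← Finset.mul_sum, ha]

end Fooling

/-! ### Symmetrization -/

section Symmetrization

lemma bit_eq_ite {B : Type*} (b : B → Bool) (i : B) : bit b i = if b i = true then 1 else 0 := by
  cases h : b i <;> simp [bit, h]

lemma chi_eq_sum_prod_bit {B : Type*} (T : Finset B) (b : B → Bool) :
    chi T b = ∑ U ∈ T.powerset, (-2) ^ U.card * ∏ i ∈ U, bit b i := by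
  have linear (i : B) : (-1 : ℝ) ^ (b i).toNat = 1 + -2 * bit b i := by
    cases h : b i <;> norm_num [bit, h]
  simp only [chi_eq_prod, linear, Finset.prod_one_add, Finset.prod_mul_distrib, Finset.prod_const]

variable {B : Type*} [Fintype B]

/-- The number of ones of a point of the cube. -/
def ones (b : B → Bool) : ℕ := ∑ i, (b i).toNat

lemma ones_eq_card (b : B → Bool) : ones b = (Finset.univ.filter fun i => b i = true).card := by
  rw [ones, Finset.card_filter]
  exact Finset.sum_congr rfl fun i _ => by cases b i <;> rfl

/-- The uniform distribution on the level `j` of the cube: the points with exactly `j` ones. -/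
def levelUniform (j : ℕ) (b : B → Bool) : ℝ :=
  if ones b = j then ((Fintype.card B).choose j : ℝ)⁻¹ else 0

lemma ones_eq_of_levelUniform_ne_zero {j : ℕ} {b : B → Bool} (h : levelUniform j b ≠ 0) :
    ones b = j := by
  contrapose! h
  exact if_neg h

variable [DecidableEq B]

lemma card_level_filter (U : Finset B) {j : ℕ} (hU : U.card ≤ j) :
    (Finset.univ.filter fun b : B → Bool => ones b = j ∧ ∀ i ∈ U, b i = true).card =
      (Fintype.card B - U.card).choose (j - U.card) := by
  rw [← Finset.card_univ, ← Finset.card_filter_powersetCard_subset _ _ _ U.subset_univ hU]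
  refine Finset.card_nbij' (fun b => Finset.univ.filter fun i => b i = true)
    (fun Z i => decide (i ∈ Z)) ?_ ?_ ?_ ?_
  · intro b hb
    simpa [ones_eq_card, Finset.subset_iff] using hb
  · intro Z hZ
    simpa [ones_eq_card, Finset.subset_iff] using hZ
  · intro b _
    simp
  · intro Z _
    simp

lemma sum_levelUniform_mul_prod_bit (U : Finset B) {j : ℕ} (hj : j ≤ Fintype.card B) :
    ∑ b, levelUniform j b * ∏ i ∈ U, bit b i =
      (j.choose U.card : ℝ) / (Fintype.card B).choose U.card := by
  have count : ∑ b, levelUniform j b * ∏ i ∈ U, bit b i =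
      (Finset.univ.filter fun b : B → Bool => ones b = j ∧ ∀ i ∈ U, b i = true).card *
        ((Fintype.card B).choose j : ℝ)⁻¹ := by
    simp only [levelUniform, bit_eq_ite, Finset.prod_boole, mul_ite, mul_one, mul_zero, ← ite_and,
      Finset.sum_ite, Finset.sum_const_zero, add_zero, Finset.sum_const, nsmul_eq_mul, and_comm]
  have hj₀ : ((Fintype.card B).choose j : ℝ) ≠ 0 := mod_cast (Nat.choose_pos hj).ne'
  have hU₀ : ((Fintype.card B).choose U.card : ℝ) ≠ 0 :=
    mod_cast (Nat.choose_pos U.card_le_univ).ne'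
  rw [count]
  rcases le_or_gt U.card j with hU | hU
  · rw [card_level_filter U hU, ← div_eq_mul_inv, div_eq_div_iff hj₀ hU₀, mul_comm,
      mul_comm (j.choose _ : ℝ)]
    exact_mod_cast (Nat.choose_mul hU).symm
  · have empty : (Finset.univ.filter fun b : B → Bool => ones b = j ∧ ∀ i ∈ U, b i = true) = ∅ := by
      refine Finset.filter_eq_empty_iff.2 fun b _ hb => hU.not_ge ?_
      rw [← hb.1, ones_eq_card]
      exact Finset.card_le_card fun i hi => by simpa using hb.2 i hi
    simp [empty, Nat.choose_eq_zero_of_lt hU]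

lemma levelUniform_mem_stdSimplex {j : ℕ} (hj : j ≤ Fintype.card B) :
    levelUniform j ∈ stdSimplex ℝ (B → Bool) := by
  refine ⟨fun b => ?_, by simpa using sum_levelUniform_mul_prod_bit (∅ : Finset B) hj⟩
  unfold levelUniform
  positivity

theorem exists_poly_sum_levelUniform_mul_chi (T : Finset B) :
    ∃ R : ℝ[X], R.natDegree ≤ T.card ∧ ∀ j ≤ Fintype.card B,
      ∑ b, levelUniform j b * chi T b = R.eval (j : ℝ) := by
  refine ⟨∑ U ∈ T.powerset,
    C ((-2 : ℝ) ^ U.card / ((Fintype.card B).choose U.card * U.card.factorial)) *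
      descPochhammer ℝ U.card, ?_, fun j hj => ?_⟩
  · refine natDegree_sum_le_of_forall_le _ _ fun U hU => (natDegree_C_mul_le _ _).trans ?_
    rw [descPochhammer_natDegree]
    exact Finset.card_le_card (Finset.mem_powerset.1 hU)
  simp only [chi_eq_sum_prod_bit, Finset.mul_sum]
  rw [Finset.sum_comm, eval_finsetSum]
  refine Finset.sum_congr rfl fun U _ => ?_
  simp only [mul_left_comm (levelUniform j _), ← Finset.mul_sum]
  have : ((Fintype.card B).choose U.card : ℝ) ≠ 0 :=
    mod_cast (Nat.choose_pos U.card_le_univ).ne'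
  have : (U.card.factorial : ℝ) ≠ 0 := mod_cast U.card.factorial_ne_zero
  rw [sum_levelUniform_mul_prod_bit U hj, eval_mul, eval_C, descPochhammer_eval_eq_descFactorial,
    Nat.descFactorial_eq_factorial_mul_choose, Nat.cast_mul]
  field_simp

end Symmetrization

section Resolves

variable {B : Type*} [Fintype B] [DecidableEq B] {f : BoolFun B} {ν : ℤ → (B → Bool) → ℝ}
  {d D : ℕ} {A : Set ℤ} {p : (B → Bool) → ℝ}

/-- The probability vectors `ν t`, for integers `t ∈ A`, are carried by points where `f` is the
sign of `t` (positive for `t = 0`), and functions of degree at most `D` average along them to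
polynomials in `t` of the same degree. -/
structure Resolves (ν : ℤ → (B → Bool) → ℝ) (f : BoolFun B) (D : ℕ) (A : Set ℤ) : Prop where
  mem_stdSimplex : ∀ t ∈ A, ν t ∈ stdSimplex ℝ (B → Bool)
  eq_sign : ∀ t ∈ A, ∀ b, ν t b ≠ 0 → f b = if t < 0 then -1 else 1
  isPolyOn_chi : ∀ T : Finset B, T.card ≤ D → IsPolyOn T.card A fun t => ∑ b, ν t b * chi T b

lemma Resolves.isPolyOn (h : Resolves ν f D A) (hd : d ≤ D) (hp : p ∈ lowDeg B d) :
    IsPolyOn d A fun t => ∑ b, ν t b * p b := by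
  induction hp using Submodule.span_induction with
  | mem _ hT =>
    obtain ⟨T, hT, rfl⟩ := hT
    obtain ⟨Q, hQ, hQ'⟩ := h.isPolyOn_chi T (hT.trans hd)
    exact ⟨Q, hQ.trans hT, hQ'⟩
  | zero => exact IsPolyOn.zero.congr fun t _ => by simp
  | add _ _ _ _ ha hb =>
    exact (ha.add hb).congr fun t _ => by simp [mul_add, Finset.sum_add_distrib]
  | smul r _ _ ha =>
    exact (ha.const_mul r).congr fun t _ => by simp [mul_left_comm, Finset.mul_sum]

/-- The function that is true exactly above level `J` of the cube. -/
def aboveLevel (B : Type*) [Fintype B] (J : ℕ) : BoolFun B := fun b => if J < ones b then -1 else 1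

theorem resolves_aboveLevel (B : Type*) [Fintype B] [DecidableEq B] (J D : ℕ) :
    Resolves (fun t => levelUniform (J - t : ℤ).toNat) (aboveLevel B J) D
      {t | t ≤ J ∧ J - t ≤ Fintype.card B} where
  mem_stdSimplex := fun t ht => levelUniform_mem_stdSimplex (by grind)
  eq_sign := fun t ht b hb => by
    have hones := ones_eq_of_levelUniform_ne_zero hb
    have above_iff : J < ones b ↔ t < 0 := by grind
    simp only [aboveLevel, above_iff]
  isPolyOn_chi := fun T _ => by
    obtain ⟨R, hR, hR'⟩ := exists_poly_sum_levelUniform_mul_chi T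
    refine (IsPolyOn.eval_add_mul hR J (-1)).congr fun t ht => (hR' _ (by grind)).trans ?_
    have level_eq : ((J - t : ℤ).toNat : ℝ) = J + -1 * t := by
      rw [← Int.cast_natCast, Int.toNat_of_nonneg (by grind)]
      push_cast
      ring
    rw [level_eq]

end Resolves

/-! ### Subset sums with carries -/

/-- The nonzero integers of absolute value less than `M`. -/
def puncturedBall (M : ℕ) : Set ℤ := {t | t ≠ 0 ∧ |t| < M}

section IntForm

variable {B : Type*} [Fintype B]

/-- The integer linear form `∑ Wᵢ bᵢ`. -/
def intForm (W : B → ℤ) (b : B → Bool) : ℤ := ∑ i, W i * (b i).toNat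

/-- The halfspace that is false exactly where `k < ∑ Wᵢ bᵢ`. -/
def intHalfspace (W : B → ℤ) (k : ℤ) : BoolFun B := fun b => if k < intForm W b then 1 else -1

lemma cast_intForm (W : B → ℤ) (b : B → Bool) :
    (intForm W b : ℝ) = ∑ i, (W i : ℝ) * bit b i := by
  simp [intForm, bit]

lemma isHalfspace_intHalfspace (W : B → ℤ) (k : ℤ) : IsHalfspace (intHalfspace W k) := by
  refine ⟨fun i => W i, k + 1 / 2, signRep_iff.2 ⟨fun b hb => ?_, fun b hb => ?_⟩⟩ <;>
    rw [← cast_intForm]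
  · have hk : k + 1 ≤ intForm W b := by
      by_contra! h
      simp [intHalfspace, Int.not_lt.2 (Int.lt_add_one_iff.1 h)] at hb
    have : (k + 1 : ℝ) ≤ intForm W b := mod_cast hk
    linarith
  · have hk : intForm W b ≤ k := by
      by_contra! h
      simp [intHalfspace, h] at hb
    have : (intForm W b : ℝ) ≤ k := mod_cast hk
    linarith

lemma cast_intForm_mem_lowDeg (W : B → ℤ) : (fun b => (intForm W b : ℝ)) ∈ lowDeg B 1 := by
  simp only [cast_intForm]
  convert (lowDeg B 1).sum_mem fun i (_ : i ∈ Finset.univ) =>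
    (lowDeg B 1).smul_mem (W i : ℝ) (bit_mem_lowDeg i)
  simp

end IntForm

section Carry

variable {X Y : Type*} [Fintype X] {M : ℕ}

/-- The subset sum `∑ wᵢ xᵢ` in `ℤ`, with the weights lifted to `[0, M)`. -/
def liftedSum (w : X → ZMod M) : (X → Bool) → ℤ := intForm fun i => (w i).val

lemma liftedSum_nonneg (w : X → ZMod M) (x : X → Bool) : 0 ≤ liftedSum w x :=
  Finset.sum_nonneg fun _ _ => by positivity

/-- The weights of the linear form `∑ wᵢ xᵢ - M ∑ yⱼ`. -/
def carryWeights (w : X → ZMod M) : X ⊕ Y → ℤ :=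
  Sum.elim (fun i => (w i).val) fun _ => -M

lemma intForm_carryWeights [Fintype Y] (w : X → ZMod M) (b : X ⊕ Y → Bool) :
    intForm (carryWeights w) b = liftedSum w (b ∘ Sum.inl) - M * ones (b ∘ Sum.inr) := by
  simp [intForm, liftedSum, carryWeights, ones, Finset.mul_sum, sub_eq_add_neg]

/-- The number of carries `(∑ wᵢ xᵢ - t) / M`, which is exact if `x` is in the residue class of
`t`. -/
def carry (w : X → ZMod M) (t : ℤ) (x : X → Bool) : ℕ := ((liftedSum w x - t) / M).toNat

variable [NeZero M]

lemma cast_liftedSum (w : X → ZMod M) (x : X → Bool) : (liftedSum w x : ZMod M) = modSum w x := by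
  simp only [liftedSum, intForm, modSum, Int.cast_sum, Int.cast_mul, Int.cast_natCast,
    ZMod.natCast_val]
  exact Finset.sum_congr rfl fun i _ => by cases x i <;> simp

lemma liftedSum_le (w : X → ZMod M) (x : X → Bool) :
    liftedSum w x ≤ Fintype.card X * ((M : ℤ) - 1) := by
  rw [← nsmul_eq_mul, ← Finset.card_univ]
  refine Finset.sum_le_card_nsmul _ _ _ fun i _ => ?_
  have : ((w i).val : ℤ) < M := mod_cast ZMod.val_lt (w i)
  cases x i <;> simp only [Bool.toNat_false, Bool.toNat_true, Nat.cast_zero, Nat.cast_one] <;> lia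

variable {w : X → ZMod M} {t : ℤ} {x : X → Bool}

lemma mul_carry (hx : modSum w x = t) (ht : t < M) : M * (carry w t x : ℤ) = liftedSum w x - t := by
  have hM : (0 : ℤ) < M := mod_cast NeZero.pos M
  obtain ⟨k, hk⟩ : (M : ℤ) ∣ liftedSum w x - t :=
    (ZMod.intCast_zmod_eq_zero_iff_dvd _ _).1 (by rw [Int.cast_sub, cast_liftedSum, hx, sub_self])
  have hk₀ : -1 < k := lt_of_mul_lt_mul_left (by linarith [liftedSum_nonneg w x]) hM.le
  rw [carry, hk, Int.mul_ediv_cancel_left _ hM.ne', Int.toNat_of_nonneg (by lia)]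

lemma carry_le (ht : -M < t) : carry w t x ≤ Fintype.card X := by
  have hM : (0 : ℤ) < M := mod_cast NeZero.pos M
  rw [carry, Int.toNat_le, ← Int.lt_add_one_iff, Int.ediv_lt_iff_lt_mul hM]
  linarith [liftedSum_le w x]

end Carry

section CarryMeasure

variable {X Y : Type*} [Fintype X] [Fintype Y] {M q : ℕ} {w : X → ZMod M}
  {ν : ZMod M → (X → Bool) → ℝ} {t : ℤ}

/-- The distribution of `(x, y)`, where `x` is drawn from the residue class of `t` according to `ν`
and `y` is uniform among the points with as many ones as there are carries in the subset sum of
`x`. -/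
def carryMeasure (w : X → ZMod M) (ν : ZMod M → (X → Bool) → ℝ) (t : ℤ) (b : X ⊕ Y → Bool) : ℝ :=
  ν t (b ∘ Sum.inl) * levelUniform (carry w t (b ∘ Sum.inl)) (b ∘ Sum.inr)

lemma intForm_carryWeights_of_carryMeasure_ne_zero [NeZero M]
    (hν : ∀ x, modSum w x ≠ t → ν t x = 0) (ht : t < M) {b : X ⊕ Y → Bool}
    (hb : carryMeasure w ν t b ≠ 0) : intForm (carryWeights w) b = t := by
  have class_eq : modSum w (b ∘ Sum.inl) = t := not_imp_comm.1 (hν _) (left_ne_zero_of_mul hb)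
  rw [intForm_carryWeights, ones_eq_of_levelUniform_ne_zero (right_ne_zero_of_mul hb),
    mul_carry class_eq ht, sub_sub_cancel]

variable [DecidableEq X] [DecidableEq Y]

lemma sum_carryMeasure_mul (w : X → ZMod M) (ν : ZMod M → (X → Bool) → ℝ) (t : ℤ)
    (g : (X ⊕ Y → Bool) → ℝ) : ∑ b, carryMeasure w ν t b * g b =
      ∑ x, ν t x * ∑ y, levelUniform (carry w t x) y * g (Sum.elim x y) := by
  rw [← (Equiv.sumArrowEquivProdArrow X Y Bool).symm.sum_comp, Fintype.sum_prod_type]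
  simp only [carryMeasure, Finset.mul_sum, ← mul_assoc]
  rfl

variable [NeZero M]

lemma carryMeasure_mem_stdSimplex (hν : ν t ∈ stdSimplex ℝ (X → Bool)) (ht : -M < t)
    (hXY : Fintype.card X = Fintype.card Y) :
    carryMeasure w ν t ∈ stdSimplex ℝ (X ⊕ Y → Bool) := by
  have level (x : X → Bool) : levelUniform (carry w t x) ∈ stdSimplex ℝ (Y → Bool) :=
    levelUniform_mem_stdSimplex (hXY ▸ carry_le ht)
  refine ⟨fun b => mul_nonneg (hν.1 _) ((level _).1 _), ?_⟩
  have total := sum_carryMeasure_mul w ν t (fun _ : X ⊕ Y → Bool => 1)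
  simpa only [mul_one, (level _).2, hν.2] using total

/-- Averaging over the carries gives `χ_U(x)` times a polynomial in `(∑ wᵢ xᵢ - t) / M`. For fixed
`t` this has low degree in `x`, so its average does not depend on the residue class. -/
lemma isPolyOn_sum_carryMeasure_mul_chi (hν : ∀ s, IsWiseUniform q (ν s))
    (hνt : ∀ s x, modSum w x ≠ s → ν s x = 0) (hXY : Fintype.card X = Fintype.card Y)
    {T : Finset (X ⊕ Y)} (hT : T.card ≤ q) :
    IsPolyOn T.card {t | |t| < M} fun t => ∑ b, carryMeasure w ν t b * chi T b := by
  obtain ⟨R, hR, hR'⟩ := exists_poly_sum_levelUniform_mul_chi T.toRight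
  have hTcard := T.card_toLeft_add_card_toRight
  have hM : (M : ℝ) ≠ 0 := mod_cast NeZero.ne M
  let c (x : X → Bool) : ℝ := liftedSum w x / M
  have average_carry (t : ℤ) (ht : |t| < M) : ∑ b, carryMeasure w ν t b * chi T b =
      ∑ x, ν t x * (chi T.toLeft x * R.eval (c x + -(1 / M) * t)) := by
    rw [sum_carryMeasure_mul]
    refine Finset.sum_congr rfl fun x _ => ?_
    by_cases hx : modSum w x = t
    · have carry_eq : (carry w t x : ℝ) = c x + -(1 / M) * t := by
        have : (M : ℝ) * carry w t x = liftedSum w x - t := mod_cast mul_carry hx (abs_lt.1 ht).2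
        simp only [c]
        field_simp
        linarith
      rw [← carry_eq, ← hR' _ (hXY ▸ carry_le (abs_lt.1 ht).1)]
      simp only [chi_sumElim, mul_left_comm (levelUniform _ _), ← Finset.mul_sum]
    · rw [hνt _ _ hx, zero_mul, zero_mul]
  have mem_lowDeg (t : ℤ) :
      (fun x => chi T.toLeft x * R.eval (c x + -(1 / M) * t)) ∈ lowDeg X q := by
    refine lowDeg_mono (by lia) (mul_mem_lowDeg (chi_mem_lowDeg le_rfl) (eval_mem_lowDeg ?_ R))
    refine (lowDeg X 1).add_mem ?_ (const_mem_lowDeg 1 _)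
    convert (lowDeg X 1).smul_mem (1 / M : ℝ) (cast_intForm_mem_lowDeg fun i => (w i).val) using 1
    ext x
    simp [c, liftedSum, div_eq_inv_mul]
  have poly : IsPolyOn T.card {t | |t| < M} fun t =>
      ∑ x, ν 0 x * chi T.toLeft x * R.eval (c x + -(1 / M) * t) :=
    IsPolyOn.sum _ fun x _ => (IsPolyOn.eval_add_mul (by lia) _ _).const_mul _
  refine poly.congr fun t ht => ?_
  rw [average_carry t ht, (hν t).sum_mul_eq (hν 0) (mem_lowDeg t)]
  simp only [mul_assoc]

theorem resolves_carry (hν : ∀ s, IsWiseUniform q (ν s)) (hνt : ∀ s x, modSum w x ≠ s → ν s x = 0)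
    (hXY : Fintype.card X = Fintype.card Y) :
    Resolves (carryMeasure w ν) (intHalfspace (carryWeights w : X ⊕ Y → ℤ) 0) q
      (puncturedBall M) where
  mem_stdSimplex := fun t ht =>
    carryMeasure_mem_stdSimplex (hν t).mem_stdSimplex (abs_lt.1 ht.2).1 hXY
  eq_sign := fun t ht b hb => by
    rw [intHalfspace, intForm_carryWeights_of_carryMeasure_ne_zero (hνt t) (abs_lt.1 ht.2).2 hb]
    have := ht.1
    grind
  isPolyOn_chi := fun T hT => by
    obtain ⟨Q, hQ, hQ'⟩ := isPolyOn_sum_carryMeasure_mul_chi hν hνt hXY hT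
    exact ⟨Q, hQ, fun t ht => hQ' t ht.2⟩

end CarryMeasure

/-! ### Density of conjunctions of lifts -/

lemma sum_mul_pos_of_mem_stdSimplex {α : Type*} [Fintype α] {ν g : α → ℝ}
    (hν : ν ∈ stdSimplex ℝ α) (hg : ∀ x, ν x ≠ 0 → 0 < g x) : 0 < ∑ x, ν x * g x := by
  obtain ⟨x, -, hx⟩ : ∃ x ∈ Finset.univ, ν x ≠ 0 :=
    Finset.exists_ne_zero_of_sum_ne_zero (hν.2 ▸ one_ne_zero)
  refine Finset.sum_pos' (fun y _ => ?_)
    ⟨x, Finset.mem_univ x, mul_pos ((hν.1 x).lt_of_ne' hx) (hg x hx)⟩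
  obtain hy | hy := eq_or_ne (ν y) 0
  · rw [hy, zero_mul]
  · exact mul_nonneg (hν.1 y) (hg y hy).le

section PairAverage

variable {B C : Type*} [Fintype B] [Fintype C] [DecidableEq B] [DecidableEq C] {f : BoolFun B}
  {g : BoolFun C} {ν : ℤ → (B → Bool) → ℝ} {μ : ℤ → (C → Bool) → ℝ} {p : (B ⊕ C → Bool) → ℝ}
  {A A' : Set ℤ} {d D D' : ℕ}

/-- The average of `p` over the product of the distributions `ν t` and `μ τ`. -/
def pairAverage (ν : ℤ → (B → Bool) → ℝ) (μ : ℤ → (C → Bool) → ℝ) (p : (B ⊕ C → Bool) → ℝ)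
    (t τ : ℤ) : ℝ :=
  ∑ x, ν t x * ∑ y, μ τ y * p (Sum.elim x y)

lemma pairAverage_pos (hf : Resolves ν f D A) (hg : Resolves μ g D' A')
    (hp : SignRep (conj f g) p) {t τ : ℤ} (ht : t ∈ A) (hτ : τ ∈ A') (h : 0 ≤ t ∨ 0 ≤ τ) :
    0 < pairAverage ν μ p t τ := by
  refine sum_mul_pos_of_mem_stdSimplex (hf.mem_stdSimplex t ht) fun x hx =>
    sum_mul_pos_of_mem_stdSimplex (hg.mem_stdSimplex τ hτ) fun y hy => hp.pos ?_
  simp only [conj, Sum.elim_inl, Sum.elim_inr, hf.eq_sign t ht x hx, hg.eq_sign τ hτ y hy]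
  grind

lemma pairAverage_neg (hf : Resolves ν f D A) (hg : Resolves μ g D' A')
    (hp : SignRep (conj f g) p) {t τ : ℤ} (ht : t ∈ A) (hτ : τ ∈ A') (ht₀ : t < 0) (hτ₀ : τ < 0) :
    pairAverage ν μ p t τ < 0 := by
  have neg_pos : 0 < ∑ x, ν t x * ∑ y, μ τ y * -p (Sum.elim x y) := by
    refine sum_mul_pos_of_mem_stdSimplex (hf.mem_stdSimplex t ht) fun x hx =>
      sum_mul_pos_of_mem_stdSimplex (hg.mem_stdSimplex τ hτ) fun y hy => neg_pos.2 (hp.neg ?_)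
    simp [conj, hf.eq_sign t ht x hx, hg.eq_sign τ hτ y hy, ht₀, hτ₀]
  simpa only [pairAverage, mul_neg, Finset.sum_neg_distrib, Left.neg_pos_iff] using neg_pos

lemma isPolyOn_pairAverage_left (hf : Resolves ν f D A) (hd : d ≤ D) (hp : p ∈ lowDeg (B ⊕ C) d)
    (τ : ℤ) : IsPolyOn d A fun t => pairAverage ν μ p t τ := by
  refine hf.isPolyOn hd ?_
  convert (lowDeg B d).sum_mem fun y (_ : y ∈ Finset.univ) =>
    (lowDeg B d).smul_mem (μ τ y) (comp_sumElim_left_mem_lowDeg hp y)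
  simp

lemma isPolyOn_pairAverage_right (hg : Resolves μ g D A') (hd : d ≤ D)
    (hp : p ∈ lowDeg (B ⊕ C) d) (t : ℤ) : IsPolyOn d A' (pairAverage ν μ p t) := by
  have mem : (fun y => ∑ x, ν t x * p (Sum.elim x y)) ∈ lowDeg C d := by
    convert (lowDeg C d).sum_mem fun x (_ : x ∈ Finset.univ) =>
      (lowDeg C d).smul_mem (ν t x) (comp_sumElim_right_mem_lowDeg hp x)
    simp
  refine (hg.isPolyOn hd mem).congr fun τ _ => ?_
  simp only [pairAverage, Finset.mul_sum]
  rw [Finset.sum_comm]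
  simp only [mul_left_comm]

theorem card_le_of_signRep_conj (hf : Resolves ν f D A) (hg : Resolves μ g D' A') (hd : d ≤ D)
    (hd' : d ≤ D') (hp : p ∈ lowDeg (B ⊕ C) d) (hs : SignRep (conj f g) p) {s u : Finset ℕ}
    {w : ℕ → ℝ} {V : ℕ} {E E' : ℝ} (hsA : ContainsGrid A s) (huA : ContainsGrid A' u)
    (hsE : DistortionBound 1 s (fun _ => 1) E) (huE : DistortionBound V u w E') (hV : 1 ≤ V)
    (hW : 0 < ∑ τ ∈ u, w τ) (hVW : 4 * (d * E') ≤ V * ∑ τ ∈ u, w τ) :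
    (s.card : ℝ) ≤ 16 * (2 * V + 1) * (d * E) :=
  card_le_of_sign_pattern (fun τ _ => isPolyOn_pairAverage_left hf hd hp τ)
    (fun t _ => isPolyOn_pairAverage_right hg hd' hp t)
    (fun _ ht _ hτ => pairAverage_neg hf hg hs ht hτ)
    (fun _ ht _ hτ h => pairAverage_pos hf hg hs ht hτ (h.imp le_of_lt le_of_lt))
    hsA huA hsE huE hV hW hVW

variable {ι κ : Type*} [Finite ι] [Finite κ] {F : BoolFun ι} {G : BoolFun κ} {q : ℕ}

lemma containsGrid_puncturedBall (q : ℕ) :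
    ContainsGrid (puncturedBall (2 ^ q)) ((Finset.range q).image (2 ^ ·)) := by
  intro t ht
  obtain ⟨i, hi, rfl⟩ := Finset.mem_image.1 ht
  have pow_lt : 2 ^ i < 2 ^ q := Nat.pow_lt_pow_right one_lt_two (Finset.mem_range.1 hi)
  have pow_pos : 0 < 2 ^ i := by positivity
  refine ⟨⟨by lia, ?_⟩, by lia, ?_⟩ <;> grind

theorem two_pow_le_dns_conj_of_distortionBound (hF : IsLift F f) (hG : IsLift G g)
    (hf : Resolves ν f q (puncturedBall (2 ^ q))) (hg : Resolves μ g q A') {u : Finset ℕ}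
    {w : ℕ → ℝ} {V : ℕ} {E' : ℝ} (huA : ContainsGrid A' u) (hu : DistortionBound V u w E')
    (hV : 1 ≤ V) (hW : 0 < ∑ τ ∈ u, w τ) (hVW : 4 * (d * E') ≤ V * ∑ τ ∈ u, w τ)
    (hq : 1152 * V * d < q) : 2 ^ d ≤ dns (conj F G) := by
  by_contra! hlt
  obtain ⟨p, hp, hs⟩ := exists_lowDeg_signRep_of_dns_lt (hF.conj hG) hlt
  have hdq : d ≤ q := by nlinarith
  have card_le := card_le_of_signRep_conj hf hg hdq hdq hp hs (containsGrid_puncturedBall q) huA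
    (distortionBound_geometric q) hu hV hW hVW
  rw [Finset.card_image_of_injective _ (Nat.pow_right_injective le_rfl), Finset.card_range]
    at card_le
  have hq' : (1152 * V * d : ℝ) < q := mod_cast hq
  have hVd : (d : ℝ) ≤ V * d := le_mul_of_one_le_left (by positivity) (mod_cast hV)
  linarith

theorem two_pow_le_dns_conj_self (hF : IsLift F f)
    (hf : Resolves ν f q (puncturedBall (2 ^ q))) (hq : 1152 * d < q) :
    2 ^ d ≤ dns (conj F F) := by
  have hq' : (1152 * d : ℝ) < q := mod_cast hq
  have weight : ∑ _ ∈ (Finset.range q).image (2 ^ ·), (1 : ℝ) = q := by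
    rw [Finset.sum_image (Nat.pow_right_injective le_rfl).injOn]
    simp
  refine two_pow_le_dns_conj_of_distortionBound hF hF hf hf (containsGrid_puncturedBall q)
    (V := 1) (by simpa using distortionBound_geometric q) le_rfl ?_ ?_ (by lia) <;> rw [weight]
  · linarith [(Nat.cast_nonneg d : (0 : ℝ) ≤ d)]
  · push_cast
    linarith [(Nat.cast_nonneg d : (0 : ℝ) ≤ d)]

end PairAverage

lemma log_sub_log_le_sum_one_div {T R : ℕ} (hT : 1 ≤ T) (hTR : T ≤ R) :
    Real.log R - Real.log T ≤ ∑ t ∈ Finset.Ico T R, 1 / (t : ℝ) := by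
  rw [← Finset.sum_Ico_sub (fun t : ℕ => Real.log t) hTR]
  refine Finset.sum_le_sum fun t ht => ?_
  have ht₀ : (0 : ℝ) < t := mod_cast hT.trans (Finset.mem_Ico.1 ht).1
  calc Real.log (t + 1 : ℕ) - Real.log t = Real.log ((t + 1 : ℕ) / t) :=
        (Real.log_div (by positivity) ht₀.ne').symm
    _ ≤ (t + 1 : ℕ) / t - 1 := Real.log_le_sub_one_of_pos (by positivity)
    _ = 1 / t := by push_cast; field_simp; ring

section Lift

variable {B ι : Type*} [Fintype B] [Fintype ι]

lemma sum_mul_fill {R : Type*} [CommRing R] (e : B × Bool × Bool ↪ ι) (ρ a b : B → Bool)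
    {W : B → R} {φ : ι → R} (hφ : ∀ r, φ (e r) = W r.1) :
    ∑ j, φ j * ((fill e (fun _ => false) ρ a b j).toNat : R) =
      ∑ i, W i * (2 * ((b i).toNat : R) + 1) := by
  rw [← Fintype.sum_of_injective e e.injective
    (fun r => W r.1 * ((blockBit (ρ r.1) (a r.1) (b r.1) r.2).toNat : R))]
  · simp only [Fintype.sum_prod_type, Fintype.sum_bool]
    refine Finset.sum_congr rfl fun i _ => ?_
    cases ρ i <;> cases a i <;> cases b i <;> simp [blockBit] <;> ring
  · intro j hj
    simp [fill, Function.extend_apply' _ _ _ hj]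
  · intro r
    rw [fill, e.injective.extend_apply, hφ]

lemma isLift_intHalfspace (e : B × Bool × Bool ↪ ι) (W : B → ℤ) :
    IsLift (intHalfspace (Function.extend e (fun r => W r.1) 0) (∑ i, W i)) (intHalfspace W 0) := by
  refine ⟨e, fun _ => false, fun ρ a b => ?_⟩
  have form_fill : intForm (Function.extend e (fun r => W r.1) 0) (fill e (fun _ => false) ρ a b) =
      2 * intForm W b + ∑ i, W i := by
    rw [intForm, sum_mul_fill (R := ℤ) e ρ a b fun r => e.injective.extend_apply _ _ r, intForm,
      Finset.mul_sum, ← Finset.sum_add_distrib]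
    exact Finset.sum_congr rfl fun i _ => by ring
  have pos_iff : (∑ i, W i < 2 * intForm W b + ∑ i, W i) ↔ 0 < intForm W b := by lia
  simp only [intHalfspace, form_fill, pos_iff]

lemma maj_eq_ite (n : ℕ) (x : Fin n → Bool) : maj n x = if n < 2 * ones x then -1 else 1 := by
  have lt_iff : (n : ℝ) / 2 < ∑ i, bit x i ↔ n < 2 * ones x := by
    rw [div_lt_iff₀' two_pos, ← Nat.cast_lt (α := ℝ)]
    simp [ones, bit]
  simp only [maj, lt_iff]

lemma isLift_maj (n : ℕ) :
    IsLift (maj n) (aboveLevel (Fin (n / 4)) ((n - 2 * (n / 4)) / 4)) := by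
  obtain ⟨e⟩ : Nonempty (Fin (n / 4) × Bool × Bool ↪ Fin n) :=
    Function.Embedding.nonempty_of_card_le (by simp; lia)
  refine ⟨e, fun _ => false, fun ρ a b => ?_⟩
  have ones_fill : ones (fill e (fun _ => false) ρ a b) = 2 * ones b + n / 4 := by
    have := sum_mul_fill (R := ℤ) e ρ a b (W := 1) (φ := 1) fun _ => rfl
    simp only [Pi.one_apply, one_mul, Finset.sum_add_distrib, ← Finset.mul_sum] at this
    zify [ones]
    simpa using this
  have above_iff : n < 2 * (2 * ones b + n / 4) ↔ (n - 2 * (n / 4)) / 4 < ones b := by lia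
  simp only [maj_eq_ite, aboveLevel, ones_fill, above_iff]

lemma isHalfspace_maj (n : ℕ) : IsHalfspace (maj n) := by
  have eq_intHalfspace : maj n = intHalfspace (fun _ => -1) (-(n / 2 : ℕ) - 1) := by
    ext x
    have form : intForm (fun _ => -1) x = -(ones x : ℤ) := by simp [intForm, ones]
    simp only [maj_eq_ite, intHalfspace, form]
    grind
  exact eq_intHalfspace ▸ isHalfspace_intHalfspace _ _

end Lift

theorem two_pow_le_dns_conj_maj {ι B : Type*} [Finite ι] [Fintype B] [DecidableEq B]
    {F : BoolFun ι} {f : BoolFun B} {ν : ℤ → (B → Bool) → ℝ} {n q d g V : ℕ} (hF : IsLift F f)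
    (hf : Resolves ν f q (puncturedBall (2 ^ q))) (hg : 2 ≤ g) (hgn : g ^ 3 ≤ n / 4 / 2)
    (hV : 1 ≤ V) (hVg : V ≤ g ^ 2) (hVd : 72 * (d : ℝ) ≤ V * Real.log g)
    (hq : 1152 * V * d < q) : 2 ^ d ≤ dns (conj F (maj n)) := by
  have hT : 1 ≤ g ^ 2 := Nat.one_le_pow _ _ (by lia)
  have hTR : g ^ 2 ≤ g ^ 3 := Nat.pow_le_pow_right (by lia) (by norm_num)
  have log_pos : 0 < Real.log g := Real.log_pos (mod_cast hg)
  have log_le : Real.log g ≤ ∑ t ∈ Finset.Ico (g ^ 2) (g ^ 3), 1 / (t : ℝ) := by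
    have := log_sub_log_le_sum_one_div hT hTR
    simp only [Nat.cast_pow, Real.log_pow] at this
    push_cast at this
    linarith
  refine two_pow_le_dns_conj_of_distortionBound hF (isLift_maj n) hf (resolves_aboveLevel _ _ q)
    (fun t ht => ?_) (distortionBound_harmonic hT hTR (Nat.cast_nonneg V) (mod_cast hVg)) hV
    (log_pos.trans_le log_le) ?_ hq
  · have := Finset.mem_Ico.1 ht
    simp only [Set.mem_ofPred_eq, Fintype.card_fin]
    lia
  · linarith [mul_le_mul_of_nonneg_left log_le (Nat.cast_nonneg (α := ℝ) V)]

/-! ### Choice of parameters -/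

lemma exists_halfspace_isLift_resolves {n : ℕ} (hn : 512 ≤ n) :
    ∃ (h : BoolFun (Fin n)) (f : BoolFun (Fin (64 * (n / 512)) ⊕ Fin (64 * (n / 512))))
      (ν : ℤ → (Fin (64 * (n / 512)) ⊕ Fin (64 * (n / 512)) → Bool) → ℝ), IsHalfspace h ∧
      IsLift h f ∧ Resolves ν f (n / 512) (puncturedBall (2 ^ (n / 512))) := by
  have hq : 1 ≤ n / 512 := by lia
  obtain ⟨w, hw⟩ := exists_weights_forall_exists_isWiseUniform
    (ι := Fin (64 * (n / 512))) hq (Fintype.card_fin _)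
  choose ν hν hνt using hw
  obtain ⟨e⟩ : Nonempty
      ((Fin (64 * (n / 512)) ⊕ Fin (64 * (n / 512))) × Bool × Bool ↪ Fin n) :=
    Function.Embedding.nonempty_of_card_le (by simp; lia)
  exact ⟨_, _, _, isHalfspace_intHalfspace _ _, isLift_intHalfspace e _,
    resolves_carry hν hνt rfl⟩

lemma exp_le_two_pow {x : ℝ} {d : ℕ} (h : x ≤ d / 2) : Real.exp x ≤ 2 ^ d := by
  have : (0 : ℝ) ≤ d := d.cast_nonneg
  calc Real.exp x ≤ Real.exp (d * Real.log 2) := by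
        gcongr
        nlinarith [Real.log_two_gt_d9]
    _ = 2 ^ d := by rw [Real.exp_nat_mul, Real.exp_log two_pos]

lemma logb_two_le_of_le_pow {n g k : ℕ} (hg : 1 ≤ g) (hn : 1 ≤ n) (h : n ≤ g ^ k) :
    Real.logb 2 n ≤ 2 * k * Real.log g := by
  have : 0 ≤ Real.log g := Real.log_nonneg (mod_cast hg)
  have log_le : Real.log n ≤ k * Real.log g := by
    rw [← Real.log_pow]
    exact Real.log_le_log (mod_cast hn) (mod_cast h)
  rw [Real.logb, div_le_iff₀ (Real.log_pos one_lt_two)]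
  have : 0 ≤ k * Real.log g := by positivity
  nlinarith [Real.log_two_gt_d9]

lemma sqrt_mul_logb_le (n : ℕ) : √((n : ℝ) * Real.logb 2 n) ≤ 2 * n := by
  have logb_le : Real.logb 2 n ≤ 2 * n := by
    rw [Real.logb, div_le_iff₀ (Real.log_pos one_lt_two)]
    nlinarith [Real.log_le_self n.cast_nonneg, Real.log_two_gt_d9, n.cast_nonneg (α := ℝ)]
  rw [Real.sqrt_le_left (by positivity)]
  nlinarith [n.cast_nonneg (α := ℝ)]

/-- The least truncation level allowed by the harmonic grid is `V ≈ d / l`, and the conjunction then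
requires `d * V ≈ d ^ 2 / l` to be below `q`: this is the origin of the bound `√(q l)` on `d`. -/
lemma exists_truncation {q g d : ℕ} {l : ℝ} (hg : 1 ≤ g) (hl : 1 ≤ l) (hd : 1 ≤ d)
    (hqg : q ≤ g ^ 3) (hlq : l ≤ q) (hdq : (d : ℝ) ^ 2 ≤ q * l / 10 ^ 8) :
    ∃ V : ℕ, 1 ≤ V ∧ V ≤ g ^ 2 ∧ 72 * (d : ℝ) ≤ V * l ∧ 1152 * V * d < q := by
  have hl₀ : 0 < l := by linarith
  have hq₀ : (0 : ℝ) < q := by linarith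
  have d_le : (d : ℝ) * 10 ^ 4 ≤ q := by
    refine (pow_le_pow_iff_left₀ (by positivity) hq₀.le two_ne_zero).1 ?_
    linarith [mul_le_mul_of_nonneg_left hlq hq₀.le]
  have sq_le : (72 * (d : ℝ)) ^ 2 ≤ ((g : ℝ) ^ 2 * l) ^ 2 := by
    have h₁ : (q : ℝ) * l ≤ g ^ 3 * l := mul_le_mul_of_nonneg_right (mod_cast hqg) hl₀.le
    have h₂ : (g : ℝ) ^ 3 * l ≤ g ^ 3 * l * (g * l) :=
      le_mul_of_one_le_right (by positivity)
        (one_le_mul_of_one_le_of_one_le (mod_cast hg) hl)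
    linarith [mul_pos hq₀ hl₀]
  have ratio_le : 72 * (d : ℝ) / l ≤ (g ^ 2 : ℕ) := by
    rw [div_le_iff₀ hl₀, Nat.cast_pow]
    exact (pow_le_pow_iff_left₀ (by positivity) (by positivity) two_ne_zero).1 sq_le
  refine ⟨⌈72 * (d : ℝ) / l⌉₊, Nat.one_le_ceil_iff.2 (by positivity), Nat.ceil_le.2 ratio_le,
    (div_le_iff₀ hl₀).1 (Nat.le_ceil _), ?_⟩
  have ceil_mul_le : (⌈72 * (d : ℝ) / l⌉₊ : ℝ) * d ≤ 72 * (q / 10 ^ 8) + d :=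
    calc (⌈72 * (d : ℝ) / l⌉₊ : ℝ) * d ≤ (72 * d / l + 1) * d := by
          gcongr
          exact (Nat.ceil_lt_add_one (by positivity)).le
      _ = 72 * (d ^ 2 / l) + d := by ring
      _ ≤ 72 * (q / 10 ^ 8) + d := by
          have : (d : ℝ) ^ 2 / l ≤ q / 10 ^ 8 := by
            rw [div_le_iff₀ hl₀]
            linarith
          linarith
  rw [← Nat.cast_lt (α := ℝ)]
  push_cast
  linarith

/-- A cube root `g` of `n / 8` serves as the lower end `g ^ 2` and the logarithmic length of the
harmonic grid `[g ^ 2, g ^ 3)`, which must fit into the levels of the majority. -/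
lemma exists_cube_scale {n : ℕ} (hn : 10 ^ 14 ≤ n) :
    ∃ g : ℕ, 1000 ≤ g ∧ g ^ 3 ≤ n / 4 / 2 ∧ n ≤ 16 * g ^ 3 := by
  have root_le := Nat.pow_nthRoot_le_iff.2 (Or.inl three_ne_zero : 3 ≠ 0 ∨ n / 4 / 2 ≠ 0)
  have lt_root := Nat.lt_pow_nthRoot_add_one three_ne_zero (n / 4 / 2)
  set g := Nat.nthRoot 3 (n / 4 / 2)
  have hg : 1000 ≤ g := by
    by_contra! hlt
    have : (g + 1) ^ 3 ≤ 1000 ^ 3 := Nat.pow_le_pow_left hlt 3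
    lia
  have succ_le : (g + 1) ^ 3 ≤ 2 * g ^ 3 := by nlinarith [sq_nonneg g]
  exact ⟨g, hg, root_le, by lia⟩

lemma exists_nat_le_le_two_mul {y : ℝ} (hy : 1 ≤ y) : ∃ d : ℕ, 1 ≤ d ∧ d ≤ y ∧ y ≤ 2 * d := by
  have one_le : 1 ≤ ⌊y⌋₊ := Nat.le_floor (mod_cast hy)
  have one_le' : (1 : ℝ) ≤ ⌊y⌋₊ := mod_cast one_le
  exact ⟨⌊y⌋₊, one_le, Nat.floor_le (by linarith), by linarith [Nat.lt_floor_add_one y]⟩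

lemma exists_parameters {n : ℕ} (hn : 10 ^ 14 ≤ n) :
    ∃ g d V : ℕ, 2 ≤ g ∧ g ^ 3 ≤ n / 4 / 2 ∧ 1 ≤ V ∧ V ≤ g ^ 2 ∧ 72 * (d : ℝ) ≤ V * Real.log g ∧
      1152 * V * d < n / 512 ∧ √((n : ℝ) * Real.logb 2 n) ≤ 10 ^ 9 * d := by
  obtain ⟨g, hg, hgn, hng⟩ := exists_cube_scale hn
  set q := n / 512
  set l := Real.log g
  have hgR : (1000 : ℝ) ≤ g := mod_cast hg
  have hgq : (g : ℝ) ≤ q := by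
    have cube_ge : 1000 * 1000 * g ≤ g ^ 3 :=
      (Nat.mul_le_mul_right g (Nat.mul_le_mul hg hg)).trans_eq (by ring)
    exact mod_cast (by lia : g ≤ q)
  have hnq : (n : ℝ) ≤ 1024 * q := mod_cast (by lia : n ≤ 1024 * q)
  have one_le_log : 1 ≤ l :=
    (Real.le_log_iff_exp_le (by linarith)).2 (by linarith [Real.exp_one_lt_three])
  have log_le : l ≤ g := Real.log_le_self g.cast_nonneg
  have logb_nonneg : 0 ≤ Real.logb 2 n := Real.logb_nonneg one_lt_two (mod_cast by lia)
  have logb_le : Real.logb 2 n ≤ 12 * l := by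
    have hn₆ : n ≤ g ^ 6 := by nlinarith [Nat.pow_le_pow_left hg 3]
    exact (logb_two_le_of_le_pow (by lia) (by lia) hn₆).trans_eq (by push_cast; ring)
  set y := √(q * l / 10 ^ 8)
  have sq_root : y ^ 2 = q * l / 10 ^ 8 := Real.sq_sqrt (by positivity)
  obtain ⟨d, hd, hdy, hyd⟩ : ∃ d : ℕ, 1 ≤ d ∧ d ≤ y ∧ y ≤ 2 * d := by
    refine exists_nat_le_le_two_mul ?_
    rw [Real.one_le_sqrt, le_div_iff₀ (by norm_num)]
    have : (10 : ℝ) ^ 14 ≤ n := mod_cast hn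
    nlinarith
  obtain ⟨V, hV, hVg, hVd, hVq⟩ := exists_truncation (by lia) one_le_log hd
    (by lia : q ≤ g ^ 3) (log_le.trans hgq)
    (sq_root ▸ pow_le_pow_left₀ d.cast_nonneg hdy 2)
  refine ⟨g, d, V, by lia, hgn, hV, hVg, hVd, hVq, ?_⟩
  have sqrt_le : √(n * Real.logb 2 n) ≤ 10 ^ 8 * y := by
    rw [Real.sqrt_le_left (by positivity), mul_pow, sq_root]
    calc n * Real.logb 2 n ≤ (1024 * q) * (12 * l) := by gcongr
      _ = 12288 * (q * l) := by ring
      _ ≤ (10 ^ 8) ^ 2 * (q * l / 10 ^ 8) := by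
        linarith [(by positivity : (0 : ℝ) ≤ q * l)]
  linarith

theorem exp_le_dns_conj_maj {ι B : Type*} [Finite ι] [Fintype B] [DecidableEq B]
    {F : BoolFun ι} {f : BoolFun B} {ν : ℤ → (B → Bool) → ℝ} {n : ℕ} (hF : IsLift F f)
    (hf : Resolves ν f (n / 512) (puncturedBall (2 ^ (n / 512)))) (hn : 10 ^ 14 ≤ n) :
    Real.exp (1 / 10 ^ 16 * √((n : ℝ) * Real.logb 2 n)) ≤ dns (conj F (maj n)) := by
  obtain ⟨g, d, V, hg, hgn, hV, hVg, hVd, hVq, hsqrt⟩ := exists_parameters hn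
  calc Real.exp (1 / 10 ^ 16 * √((n : ℝ) * Real.logb 2 n)) ≤ 2 ^ d := exp_le_two_pow (by linarith)
    _ ≤ dns (conj F (maj n)) := mod_cast two_pow_le_dns_conj_maj hF hf hg hgn hV hVg hVd hVq

theorem exp_le_dns_conj_self {ι B : Type*} [Finite ι] [Fintype B] [DecidableEq B]
    {F : BoolFun ι} {f : BoolFun B} {ν : ℤ → (B → Bool) → ℝ} {n : ℕ} (hF : IsLift F f)
    (hf : Resolves ν f (n / 512) (puncturedBall (2 ^ (n / 512)))) (hn : 10 ^ 14 ≤ n) :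
    Real.exp (1 / 10 ^ 16 * n) ≤ dns (conj F F) := by
  have le_mul : n ≤ 10 ^ 8 * ((n / 512 - 1) / 1152) := by lia
  have le_mul' : (n : ℝ) ≤ 10 ^ 8 * ((n / 512 - 1) / 1152 : ℕ) := mod_cast le_mul
  calc Real.exp (1 / 10 ^ 16 * n) ≤ 2 ^ ((n / 512 - 1) / 1152) := exp_le_two_pow (by linarith)
    _ ≤ dns (conj F F) := mod_cast two_pow_le_dns_conj_self hF hf (by lia)

theorem two_le_dns_conj_maj {n : ℕ} (hn : 1 ≤ n) : 2 ≤ dns (conj (maj n) (maj n)) := by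
  have true_value : ∃ x, maj n x = -1 := ⟨fun _ => true, by simp [maj_eq_ite, ones]; lia⟩
  have false_value : ∃ x, maj n x = 1 := ⟨fun _ => false, by simp [maj_eq_ite, ones]⟩
  exact two_le_dns_conj true_value false_value true_value false_value

theorem exists_halfspace_exp_le_dns {n : ℕ} (hn : 1 ≤ n) : ∃ h : BoolFun (Fin n), IsHalfspace h ∧
    Real.exp (1 / 10 ^ 16 * n) ≤ dns (conj h h) ∧
    Real.exp (1 / 10 ^ 16 * √((n : ℝ) * Real.logb 2 n)) ≤ dns (conj h (maj n)) := by
  obtain hlarge | hsmall := le_or_gt (10 ^ 14) n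
  · obtain ⟨h, f, ν, hh, hl, hr⟩ := exists_halfspace_isLift_resolves (n := n) (by lia)
    exact ⟨h, hh, exp_le_dns_conj_self hl hr hlarge, exp_le_dns_conj_maj hl hr hlarge⟩
  · have n_le : (n : ℝ) ≤ 10 ^ 14 := mod_cast hsmall.le
    have exp_le {x : ℝ} (hx : x ≤ 1 / 2) : Real.exp x ≤ dns (conj (maj n) (maj n)) :=
      (exp_le_two_pow (d := 1) (by simpa using hx)).trans (mod_cast two_le_dns_conj_maj hn)
    refine ⟨maj n, isHalfspace_maj n, exp_le ?_, exp_le ?_⟩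
    · linarith
    · linarith [sqrt_mul_logb_le n]

end ThresholdDensity

end

open ThresholdDensity

theorem theorem6p4 :
    ∃ h : (n : ℕ) → ThresholdDensity.BoolFun (Fin n),
      (∀ n : ℕ, 1 ≤ n → ThresholdDensity.IsHalfspace (h n)) ∧
      (∃ c : ℝ, 0 < c ∧ ∀ n : ℕ, 1 ≤ n →
        Real.exp (c * (n : ℝ)) ≤
          (ThresholdDensity.dns (ThresholdDensity.conj (h n) (h n)) : ℝ)) ∧
      (∃ c : ℝ, 0 < c ∧ ∀ n : ℕ, 1 ≤ n →
        Real.exp (c * Real.sqrt ((n : ℝ) * Real.logb 2 (n : ℝ))) ≤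
          (ThresholdDensity.dns
            (ThresholdDensity.conj (h n) (ThresholdDensity.maj n)) : ℝ)) := by
  choose! h hhalf hself hmaj using fun (n : ℕ) (hn : 1 ≤ n) => exists_halfspace_exp_le_dns hn
  exact ⟨h, hhalf, ⟨_, by norm_num, hself⟩, ⟨_, by norm_num, hmaj⟩⟩
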